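/- **Theorem (the CBCAST protocol is vacuum convergent).** For every lossless conforming history $H$ of the CBCAST protocol and every halting process $P$ of $H$ such that $P$ is a member of view zero or the parent of $P$ processes the notification that announces the joining of $P$, the vacuum loop at $P$ terminates: its starting state (the halting state of $P$) is well defined, it has no infinite run, and every run that cannot be continued has reached the exit of the loop. (Thus CBCAST satisfies the hypothesis "vacuum convergent" of the Fault Theorem.) The notions are as follows. *Histories.* There are processes, some of which halt; $N\in\{1,2,\dots,\infty\}$ finite views $V_i$ ($0\le i<N$); each process $P$ belongs exactly to the views $j(P)\le i<r(P)\le N$, with $j(P)<r(P)$, and each view after $V_0$ differs from the preceding one by the addition of one process $J$ (which has a parent in that preceding view) or the removal of one process. $P$ is *removed* if $r(P)<N$. Each packet $k$ belongs to one channel $C_{PQ}$ from its source $P$ to its target $Q$, has a content, and may be sent and, if sent, may be received. For $j(P)\le i<r(P)$ there is a notification $n_i(P)$: for $i=j(P)$ it introduces $P$ itself, otherwise it announces the process that joins (with its parent) or is removed at view $i$; and $n_{r(P)}(P)$, if $r(P)<\infty$ and $P$ is removed or halts, tells $P$ that it is no longer a member. Notifications may be dropped. Each broadcast request is issued at one process.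 Events are the queuing $q(k)$ of a packet (at its source; finitely many packets with the same content and source and different targets, a multicast, share one queuing event), the dequeuing $d(k)$ of a packet (at its target), the dequeuing $N_i(P)$ of a notification and the dequeuing of a request. $E_P$ is the set of events at $P$. Events carry a weak order $\preceq$, where $e\prec f$ means $e\preceq f\not\preceq e$, and $e\asymp f$ means $e\preceq f\preceq e$. The axioms are: (1) each packet has its queuing event and at most one dequeuing event, with $q(k)\prec d(k)$; channels are FIFO without gaps; (2) $N_0(P)$ exists if $j(P)=0$; notifications are dequeued in order of views, without gaps; if $N_{j(J)}(J)$ exists and $j(J)>0$, then $N_{j(J)}(E)$ exists for the parent $E$ of $J$ and $N_{j(J)}(E)\asymp N_{j(J)}(J)$; (3) $\prec$ is linear on $E_P$ and every event of $E_P$ has finitely many predecessors in $E_P$; if $E_P\ne\emptyset$, then $N_{j(P)}(P)$ is its first event, and $N_{r(P)}(P)$, if it exists, is its last; $\preceq$ is generated by the orders on the sets $E_P$, by $q(k)\prec d(k)$, and by the relations $\asymp$ of (2); (4) if $k\in C_{PQ}$, then $Q\in V_{j(P)}$ or $N_{j(Q)}(P)\prec q(k)$, and if $N_{r(Q)}(P)$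 exists then $q(k)\prec N_{r(Q)}(P)$; (5) if $k\in C_{PQ}$, $d(k)$ exists, and $i\le j(P)$ or $N_i(P)\prec q(k)$, then $i\le j(Q)$ or $N_i(Q)\prec d(k)$; (6) if $k\in C_{PP}$ and $q(k)\prec N_i(P)$, then $d(k)\prec N_i(P)$; (7) if $P$ halts, then $E_P$ and the set of requests issued at $P$ are finite; (8) dropped notifications are not dequeued; a non-halting process dequeues every notification $n_i(P)$ such that no $n_{i'}(P)$ with $i'\le i$ is dropped; (9) a non-halting process sends all packets that it queues; only received packets are dequeued; if $P,Q$ do not halt, $k\in C_{PQ}$, and all $k'\in C_{PQ}$ with $q(k')\preceq q(k)$ are received, then $d(k)$ exists; a non-halting process dequeues all its requests. *Conforming.* If only finitely many packets of $C_{PQ}$ are dequeued, then $P$ is removed or $Q$ halts; no process dequeues a packet from $Q$ after the notification of the removal of $Q$; dropped notifications occur only at halting processes; $r(P)<\infty$ if $P$ halts; a process with $E_P=\emptyset$ has no children; removed processes halt. *Lossless.* Call $C_{PQ}$ downstream if $r(Q)<r(P)$ or $P=Q$, and upstream otherwise. $H$ is lossless if every sent packet is received, no notification is dropped, all received upstream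 packets are dequeued, and all downstream packets are sent. *Histories of a protocol.* A protocol consists of six calls, each of which maps the state of a process to a new state and a finite sequence of multicasts (side effects). The event sequence of each process consists of transactions: a dequeuing event (trigger) followed by the queuing events of the side effects of the corresponding call: protBroadcast for requests, protPacket for packets, protRemove and protJoin for removal and join notifications, and for the first event protStart (original processes) or protRun, applied to the state of the parent $E$ just before $N_{j(P)}(E)$ (joining processes); the final notification has no effect. Only the last transaction of a halting process may be incomplete. *Vacuum loop at a halting process $P$.* Let $v$ be the highest view with $N_v(P)\in E_P$ ($v=j(P)-1$ if $E_P=\emptyset$). Whenever side effects arise, their queuing events are appended to $E_P$; new upstream packets stay unsent in their send queues, and new downstream packets are sent and received, and so appended to their receive queues. (i) If $N_{r(P)}(P)$ is the last event of $E_P$, remove it and set $v=r(P)-1$. (ii) Carry out the remaining side effects of the current item. (iii) If $v\ge j(P)$, dequeue and process all pending requests, one by one, in any order. (iv) If $v=r(P)-1$, dequeue and process all packets in the receive queues of the channels $C_{QP}$, $Q\ne P$, each channel in FIFO order, with any interleaving. (v) Dequeue and process, in order, the packets in the receive queue of $C_{PP}$, including those that are added meanwhile, until it is empty. (vi) Increment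 $v$. If $v=r(P)$, append $N_{r(P)}(P)$ and exit. Otherwise dequeue and process $n_v(P)$ (by protRun, in the state of the parent just before its event for view $v$, if $v=j(P)$), and go to (iii). *CBCAST.* A message carries its originator, view and vector time. The state of a process consists of: $cur\_view$; $v\_gap$; $self$; sets $MSet$, $LiveSet$, $ContactSet$ of processes; a queue of pending view changes; the vector time $vt[\cdot]$; the set $ReceiveSet$ of undelivered messages; message queues $FwdQueue[\cdot]$; $WaitSet=BcastWaitSet\cup FwdWaitSet$, a set of records $\langle msg,index,iset[\cdot]\rangle$; $LaunchQueue$; the user's replicated data; $ghost\_height$, $flush\_height$, $ghost[\cdot]$, $flush[\cdot]$; counters $mpkt\_out$ and $mpkt\_in[\cdot]$ with fields $b$ (broadcast) and $f$ (forwarded). Write $h=cur\_view+v\_gap$ and $|c|=c.b+c.f$. "Send" means multicast. - CheckFlush: if $FwdWaitSet\neq\emptyset$, return. If $ghost\_height<h$, set it to $h$ and send a ghost packet $h$ to $ContactSet$. If $BcastWaitSet\ne\emptyset$, return. If $flush\_height<h$, set it to $h$ and send a flush packet $h$ to $ContactSet$. - protBroadcast($m$): if $v\_gap>0$, append $m$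 to $LaunchQueue$. Otherwise increment $mpkt\_out.b$, stamp $m$ with $self$, $cur\_view$ and $vt$, where $vt[self]$ is replaced by $vt[self]+mpkt\_out.b-mpkt\_in[self].b$, send it to $ContactSet$, and add $\langle m,mpkt\_out,mpkt\_in\rangle$ to $BcastWaitSet$. - protStart($roster$, $P$): all views, gaps, heights, counters and vector entries (indexed by $roster$) are zero, all queues and the receive and wait sets are empty, $self=P$, $MSet=LiveSet=ContactSet=roster$. - protRun($J$): increment $v\_gap$, enqueue JOIN $J$ as pending, add $J$ to $LiveSet$, set $ContactSet=\{J\}$, $FwdQueue[J]=\emptyset$, $BcastWaitSet=\emptyset$, $index.b=0$ in all records of $FwdWaitSet$, $LaunchQueue=\emptyset$, $flush\_height=ghost[J]=flush[J]=ghost\_height$, $mpkt\_out.b=0$, $mpkt\_in[J]=mpkt\_out$, $self=J$; CheckFlush. - protRemove($R$): increment $v\_gap$, enqueue REMOVE $R$ as pending, remove $R$ from $LiveSet$ and $ContactSet$, discard $iset[R]$ in all records of $WaitSet$ and remove the records with empty $iset$, discard $mpkt\_in[R]$. For each message of $FwdQueue[R]$, in order: increment $mpkt\_out.f$, send the message to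 $ContactSet$, add $\langle msg,mpkt\_out,mpkt\_in\rangle$ to $FwdWaitSet$. Discard $FwdQueue[R]$, $ghost[R]$, $flush[R]$; CheckFlush. - protJoin($J,E$): increment $v\_gap$, enqueue JOIN $J$ as pending, add $J$ to $LiveSet$ and $ContactSet$, set $FwdQueue[J]=\emptyset$; in every record of $WaitSet$ with an entry $iset[E]$ create $iset[J]=(f=iset[E].f,b=0)$; set $ghost[J]=flush[J]=ghost[E]$, $mpkt\_in[J]=(f=mpkt\_in[E].f,b=0)$; send to $J$ the donation $\langle WaitSet,mpkt\_in,ghost\_height,flush\_height\rangle$; CheckFlush. - Message packet from $S$: send an acknowledgement to $S$; increment $mpkt\_in[S].b$ or $.f$ according as $S$ is the originator or not. If the message is of an earlier view, or of the current view and already delivered according to $vt$, or already in $ReceiveSet$, nothing else. Otherwise add it to $ReceiveSet$ and $FwdQueue[S]$, and Scan. - Acknowledgement from $S$: discard $iset[S]$ in the record of the message; if $iset$ becomes empty, remove the record and CheckFlush. - Ghost packet $x$ from $S$: set $ghost[S]=x$. Flush packet $x$ from $S$: set $flush[S]=x$, and TryToInstall. - Donation $D$ from $S$: add $S$ to $ContactSet$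 and send $S$ the co-donation $\langle WaitSet,mpkt\_in,ghost\_height,flush\_height\rangle$. List the records of $WaitSet$ that have an entry $iset[S]$, with key $(|index|,0)$, and the records of $D.WaitSet$ that have an entry $iset[self]$, with key $(|iset[self]|,|index|)$, in lexicographic order of the keys. Then go through the list: a record of $D$ with $|index|>|mpkt\_in[S]|$ is processed as a message packet from $S$, and a local record with $|index|\le|D.mpkt\_in[self]|$ as an acknowledgement from $S$. Finally set $ghost[S]$ and $flush[S]$ to the heights in $D$. Co-donation from $S$: the same without the change of $ContactSet$ and the reply, and with TryToInstall at the end. - TryToInstall: if $flush[p]<h$ for some $p\in LiveSet$, return. While $v\_gap>0$: remove the messages of the current view from $ReceiveSet$ and from $FwdQueue[p]$, $p\in LiveSet$; increment $cur\_view$ and decrement $v\_gap$; apply the first pending view change to $MSet$ and to the replicated data; reset $vt$ to zero on $MSet$; Scan. Then empty $LaunchQueue$ by protBroadcast of its messages in order. - Scan: go through $ReceiveSet$ and deliver each message $m$ of the current view whose vector time is $vt[o]+1$ at its originator $o$ and at most $vt[p]$ at the other $p\in MSet$ (increment $vt[o]$, remove $m$ from $ReceiveSet$, apply it to the replicated data);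 repeat as long as messages are delivered. The order in which elements of sets are visited, the breaking of ties in sorting, and the callbacks of the user application are arbitrary. -/

import Mathlib

universe u

noncomputable section

open scoped Classical

/-! ## Protocols -/

/-- One multicast: identical packets with this content are appended to the send queues of the
channels to all the targets. -/
structure Multicast (Proc C : Type u) where
  content : C
  targets : Finset Proc

/-- A protocol: process states, packet contents and the six non-blocking calls.  Each call maps the
current state of the process to its new state together with the multicasts (side effects) that it
makes, in the order in which they are made.  `M` is the type of contents of broadcast requests. -/
structure Protocol (Proc M : Type u) where
  State : Type u
  Content : Type u
  /-- `protStart(roster, P)`; it sets up the whole state of an original process. -/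
  start : Finset Proc → Proc → State × List (Multicast Proc Content)
  /-- `protRun(P)`, called at the child, in the state that was copied from the parent. -/
  run : Proc → State → State × List (Multicast Proc Content)
  /-- `protRemove(R)` -/
  remove : Proc → State → State × List (Multicast Proc Content)
  /-- `protJoin(J, E)` -/
  join : Proc → Proc → State → State × List (Multicast Proc Content)
  /-- `protPacket(k, S)` -/
  packet : Content → Proc → State → State × List (Multicast Proc Content)
  /-- `protBroadcast(m)` -/
  broadcast : M → State → State × List (Multicast Proc Content)

/-! ## The data of a history -/

/-- Possible events.  `queue x` is a queuing event (the packets of the multicast `x` are appended to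
their send queues), `deq k` the dequeuing of the packet `k`, `notify i P` the dequeuing of the
notification for view `i` at `P`, and `request r` the dequeuing of the broadcast request `r`. -/
inductive Event (Proc Pkt Mc Req : Type u) where
  | queue (x : Mc)
  | deq (k : Pkt)
  | notify (i : ℕ) (P : Proc)
  | request (r : Req)

/-- The contents of a membership notification. -/
inductive Notification (Proc : Type u) where
  | removed (R : Proc)
  | joined (J E : Proc)
  | new (P : Proc)
  | dead

/-- The raw data of a history with packet contents in `C` and broadcast requests in `M`.
`Proc`, `Pkt` and `Req` are the sets of processes, packets and requests. -/
structure HistoryData (Proc Pkt Mc Req C M : Type u) where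
  halts : Set Proc
  numViews : ℕ∞
  /-- The members of view `i`; meaningful for `i < numViews`. -/
  view : ℕ → Finset Proc
  /-- The first view of a process. -/
  joinView : Proc → ℕ
  /-- The end of the view interval of a process (`numViews` if it is not removed). -/
  removalView : Proc → ℕ∞
  /-- The parent; meaningful for processes with `0 < joinView`. -/
  parent : Proc → Proc
  source : Pkt → Proc
  target : Pkt → Proc
  content : Pkt → C
  /-- The multicast (queuing event) that queues the packet. -/
  multicast : Pkt → Mc
  sent : Set Pkt
  received : Set Pkt
  /-- The notifications `(i, P)` that are dropped. -/
  dropped : Set (ℕ × Proc)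
  issuer : Req → Proc
  reqContent : Req → M
  /-- The events that exist. -/
  events : Set (Event Proc Pkt Mc Req)
  /-- The weak order `e ≼ f` on events. -/
  le : Event Proc Pkt Mc Req → Event Proc Pkt Mc Req → Prop

namespace HistoryData

variable {Proc Pkt Mc Req C M : Type u} (H : HistoryData Proc Pkt Mc Req C M)

/-- `e ≺ f`. -/
def lt (e f : Event Proc Pkt Mc Req) : Prop := H.le e f ∧ ¬ H.le f e

/-- `e ≍ f`: contemporaneous events. -/
def contemporaneous (e f : Event Proc Pkt Mc Req) : Prop := H.le e f ∧ H.le f e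

/-- The queuing event of a packet. -/
def queueEvent (k : Pkt) : Event Proc Pkt Mc Req := .queue (H.multicast k)

/-- The set of events that occur at `P`. -/
def eventsAt (P : Proc) : Set (Event Proc Pkt Mc Req) :=
  {e | e ∈ H.events ∧
    ((∃ k, e = H.queueEvent k ∧ H.source k = P) ∨ (∃ k, e = .deq k ∧ H.target k = P) ∨
      (∃ i, e = .notify i P) ∨ (∃ r, e = .request r ∧ H.issuer r = P))}

/-- The channel from `P` to `Q`. -/
def channel (P Q : Proc) : Set Pkt := {k | H.source k = P ∧ H.target k = Q}

def isRemoved (P : Proc) : Prop := H.removalView P < H.numViews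

/-- `H.Notifies i P c`: there is a notification for view `i` at `P`, and its content is `c`.  This
includes the artificial notifications: the one for view zero at original processes and the final
one at processes that halt without being removed. -/
inductive Notifies : ℕ → Proc → Notification Proc → Prop
  | join (i : ℕ) (P J : Proc) (h₁ : H.joinView P < i) (h₂ : (i : ℕ∞) < H.removalView P)
      (h : H.joinView J = i) : Notifies i P (.joined J (H.parent J))
  | remove (i : ℕ) (P R : Proc) (h₁ : H.joinView P < i) (h₂ : (i : ℕ∞) < H.removalView P)
      (h : H.removalView R = i) : Notifies i P (.removed R)
  | new (P : Proc) : Notifies (H.joinView P) P (.new P)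
  | dead (i : ℕ) (P : Proc) (h₁ : H.removalView P = i) (h₂ : H.isRemoved P ∨ P ∈ H.halts) :
      Notifies i P .dead

/-- The notification for view `i` at `P` exists. -/
def hasNotification (i : ℕ) (P : Proc) : Prop := ∃ c, H.Notifies i P c

/-- The relations that generate the event order. -/
def generating (e f : Event Proc Pkt Mc Req) : Prop :=
  (∃ P, e ∈ H.eventsAt P ∧ f ∈ H.eventsAt P ∧ H.le e f) ∨
  (∃ k, e = H.queueEvent k ∧ f = .deq k ∧ f ∈ H.events) ∨
  (∃ J, 0 < H.joinView J ∧ .notify (H.joinView J) J ∈ H.events ∧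
    ((e = .notify (H.joinView J) (H.parent J) ∧ f = .notify (H.joinView J) J) ∨
      (e = .notify (H.joinView J) J ∧ f = .notify (H.joinView J) (H.parent J))))

/-! ## The axioms -/

/-- The model axioms. -/
structure IsHistory : Prop where
  numViews_pos : 0 < H.numViews
  received_sent : H.received ⊆ H.sent
  -- views
  view_interval : ∀ P, (H.joinView P : ℕ∞) < H.removalView P ∧
    {i : ℕ | (i : ℕ∞) < H.numViews ∧ P ∈ H.view i} =
      {i : ℕ | H.joinView P ≤ i ∧ (i : ℕ∞) < H.removalView P}
  view_change : ∀ i : ℕ, ((i + 1 : ℕ) : ℕ∞) < H.numViews →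
    (∃ P, P ∉ H.view i ∧ H.view (i + 1) = insert P (H.view i)) ∨
    (∃ P, P ∈ H.view i ∧ H.view (i + 1) = (H.view i).erase P)
  parent_member : ∀ J, 0 < H.joinView J → H.parent J ∈ H.view (H.joinView J - 1)
  -- packets
  queue_mem : ∀ k, H.queueEvent k ∈ H.events
  queue_packet : ∀ x, .queue x ∈ H.events → ∃ k, H.multicast k = x
  queue_lt_deq : ∀ k, .deq k ∈ H.events → H.lt (H.queueEvent k) (.deq k)
  multicast_finite : ∀ x, {k | H.multicast k = x}.Finite
  multicast_same : ∀ k k', H.multicast k = H.multicast k' →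
    H.content k = H.content k' ∧ H.source k = H.source k'
  multicast_target : ∀ k k', H.multicast k = H.multicast k' → H.target k = H.target k' → k = k'
  packet_order : ∀ k k', H.source k = H.source k' → H.target k = H.target k' →
    H.lt (H.queueEvent k) (H.queueEvent k') → .deq k' ∈ H.events →
    .deq k ∈ H.events ∧ H.lt (.deq k) (.deq k')
  -- notifications
  notify_exists : ∀ i P, .notify i P ∈ H.events → H.hasNotification i P
  notify_zero : ∀ P, H.joinView P = 0 → .notify 0 P ∈ H.events
  notify_order : ∀ P (i i' : ℕ), H.joinView P ≤ i → i < i' → (i' : ℕ∞) ≤ H.removalView P →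
    .notify i' P ∈ H.events → .notify i P ∈ H.events ∧ H.lt (.notify i P) (.notify i' P)
  parent_event : ∀ J, 0 < H.joinView J → .notify (H.joinView J) J ∈ H.events →
    .notify (H.joinView J) (H.parent J) ∈ H.events ∧
      H.contemporaneous (.notify (H.joinView J) (H.parent J)) (.notify (H.joinView J) J)
  -- the event order
  process_order : ∀ P, ∀ e ∈ H.eventsAt P, ∀ f ∈ H.eventsAt P, e ≠ f → H.lt e f ∨ H.lt f e
  minimal_order : ∀ e f, H.le e f ↔
    e ∈ H.events ∧ f ∈ H.events ∧ Relation.ReflTransGen H.generating e f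
  process_liveness : ∀ k,
    (H.target k ∈ H.view (H.joinView (H.source k)) ∨
      (.notify (H.joinView (H.target k)) (H.source k) ∈ H.events ∧
        H.lt (.notify (H.joinView (H.target k)) (H.source k)) (H.queueEvent k))) ∧
    (∀ i : ℕ, H.removalView (H.target k) = i → .notify i (H.source k) ∈ H.events →
      H.lt (H.queueEvent k) (.notify i (H.source k)))
  piggyback : ∀ k, .deq k ∈ H.events → ∀ i : ℕ,
    (i ≤ H.joinView (H.source k) ∨
      (.notify i (H.source k) ∈ H.events ∧ H.lt (.notify i (H.source k)) (H.queueEvent k))) →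
    (i ≤ H.joinView (H.target k) ∨
      (.notify i (H.target k) ∈ H.events ∧ H.lt (.notify i (H.target k)) (.deq k)))
  self_channel : ∀ P, ∀ k ∈ H.channel P P, ∀ i : ℕ, .notify i P ∈ H.events →
    H.lt (H.queueEvent k) (.notify i P) → .deq k ∈ H.events ∧ H.lt (.deq k) (.notify i P)
  order_foundation : ∀ P, ∀ e ∈ H.eventsAt P, {f ∈ H.eventsAt P | H.lt f e}.Finite
  first_event : ∀ P, (H.eventsAt P).Nonempty → .notify (H.joinView P) P ∈ H.events ∧
    ∀ e ∈ H.eventsAt P, H.le (.notify (H.joinView P) P) e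
  last_event : ∀ P (i : ℕ), H.removalView P = i → .notify i P ∈ H.events →
    ∀ e ∈ H.eventsAt P, H.le e (.notify i P)
  -- halting
  halt_finite : ∀ P ∈ H.halts, (H.eventsAt P).Finite
  /-- Only finitely many requests are issued at a process that halts. -/
  halt_requests : ∀ P ∈ H.halts, {r | H.issuer r = P}.Finite
  dropped_exists : ∀ P i, (i, P) ∈ H.dropped → H.hasNotification i P
  dropped_notify : ∀ P i, (i, P) ∈ H.dropped → .notify i P ∉ H.events
  halt_notify : ∀ P ∉ H.halts, ∀ i, H.hasNotification i P →
    (∀ i' ≤ i, (i', P) ∉ H.dropped) → .notify i P ∈ H.events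
  halt_sent : ∀ k, H.source k ∉ H.halts → k ∈ H.sent
  deq_received : ∀ k, .deq k ∈ H.events → k ∈ H.received
  halt_deq : ∀ k, H.source k ∉ H.halts → H.target k ∉ H.halts →
    (∀ k', H.source k' = H.source k → H.target k' = H.target k →
      H.le (H.queueEvent k') (H.queueEvent k) → k' ∈ H.received) → .deq k ∈ H.events
  halt_request : ∀ r, H.issuer r ∉ H.halts → .request r ∈ H.events

/-- The axioms of conforming histories. -/
structure IsConforming : Prop where
  channel : ∀ P Q, {k ∈ H.channel P Q | .deq k ∈ H.events}.Finite → H.isRemoved P ∨ Q ∈ H.halts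
  packet : ∀ k, ∀ i : ℕ, H.removalView (H.source k) = i → H.isRemoved (H.source k) →
    .notify i (H.target k) ∈ H.events → .deq k ∈ H.events →
    ¬ H.lt (.notify i (H.target k)) (.deq k)
  notification : ∀ P i, (i, P) ∈ H.dropped → P ∈ H.halts
  membership : ∀ P ∈ H.halts, H.removalView P ≠ ⊤
  parent : ∀ P, H.eventsAt P = ∅ → ∀ J, 0 < H.joinView J → H.parent J ≠ P
  halt : ∀ P, H.isRemoved P → P ∈ H.halts

/-- The channel from `P` to `Q` is upstream. -/
def upstream (P Q : Proc) : Prop := H.removalView P ≤ H.removalView Q ∧ P ≠ Q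

/-- The channel from `P` to `Q` is downstream. -/
def downstream (P Q : Proc) : Prop := H.removalView Q < H.removalView P ∨ P = Q

/-- Lossless histories. -/
structure IsLossless : Prop where
  packets : ∀ k ∈ H.sent, k ∈ H.received
  notifications : ∀ P i, (i, P) ∉ H.dropped
  upstream : ∀ k, H.upstream (H.source k) (H.target k) → k ∈ H.received → .deq k ∈ H.events
  downstream : ∀ k, H.downstream (H.source k) (H.target k) → k ∈ H.sent

/-! ## Executions of a protocol -/

/-- `l` lists, newest first, the events of an initial segment of the event sequence of `P`. -/
def IsSegment (P : Proc) (l : List (Event Proc Pkt Mc Req)) : Prop :=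
  l.Pairwise (fun e f => H.lt f e) ∧ (∀ e ∈ l, e ∈ H.eventsAt P) ∧
    ∀ e ∈ l, ∀ f ∈ H.eventsAt P, H.lt f e → f ∈ l

/-- The multicast `x` of the history has this content and these targets. -/
def Realizes (x : Mc) (m : Multicast Proc C) : Prop :=
  (∀ k, H.multicast k = x → H.content k = m.content) ∧
    H.target '' {k | H.multicast k = x} = (m.targets : Set Proc)

end HistoryData

section Execution

variable {Proc Pkt Mc Req M : Type u} (prot : Protocol Proc M)
  (H : HistoryData Proc Pkt Mc Req prot.Content M)

/-- `Processes prot H P s e t`: in state `s` the process `P` dequeues an item, which is the trigger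
event `e` (other than the first event of `P`), and `t` is the resulting state together with the side
effects that are to follow. -/
inductive Processes (P : Proc) (s : prot.State) : Event Proc Pkt Mc Req →
    prot.State × List (Multicast Proc prot.Content) → Prop
  | request (r : Req) (h : H.issuer r = P) :
      Processes P s (.request r) (prot.broadcast (H.reqContent r) s)
  | packet (k : Pkt) (h : H.target k = P) :
      Processes P s (.deq k) (prot.packet (H.content k) (H.source k) s)
  | removed (i : ℕ) (R : Proc) (h : H.Notifies i P (.removed R)) :
      Processes P s (.notify i P) (prot.remove R s)
  | joined (i : ℕ) (J E : Proc) (h : H.Notifies i P (.joined J E)) :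
      Processes P s (.notify i P) (prot.join J E s)
  | dead (i : ℕ) (h : H.Notifies i P .dead) : Processes P s (.notify i P) (s, [])

/-- `LocalRun prot H P l (s, out)`: after going through the events in the list `l` (newest first)
according to the protocol, the process `P` has the state `s` and the side effects `out` of its
current transaction are still to be carried out.  An empty multicast makes no event. -/
inductive LocalRun : Proc → List (Event Proc Pkt Mc Req) →
    prot.State × List (Multicast Proc prot.Content) → Prop
  | start (P : Proc) (h : H.joinView P = 0) :
      LocalRun P [.notify 0 P] (prot.start (H.view 0) P)
  | fork (P : Proc) (h : 0 < H.joinView P) (l : List (Event Proc Pkt Mc Req)) (s : prot.State)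
      (hs : LocalRun (H.parent P) l (s, []))
      (hl : H.IsSegment (H.parent P) (.notify (H.joinView P) (H.parent P) :: l)) :
      LocalRun P [.notify (H.joinView P) P] (prot.run P s)
  | trigger (P : Proc) (l : List (Event Proc Pkt Mc Req)) (s : prot.State)
      (e : Event Proc Pkt Mc Req) (t : prot.State × List (Multicast Proc prot.Content))
      (hs : LocalRun P l (s, [])) (ht : Processes prot H P s e t) : LocalRun P (e :: l) t
  | effect (P : Proc) (l : List (Event Proc Pkt Mc Req)) (s : prot.State)
      (m : Multicast Proc prot.Content) (out : List (Multicast Proc prot.Content)) (x : Mc)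
      (hs : LocalRun P l (s, m :: out)) (hx : H.Realizes x m) (hm : m.targets.Nonempty) :
      LocalRun P (.queue x :: l) (s, out)
  | skip (P : Proc) (l : List (Event Proc Pkt Mc Req)) (s : prot.State)
      (m : Multicast Proc prot.Content) (out : List (Multicast Proc prot.Content))
      (hs : LocalRun P l (s, m :: out)) (hm : m.targets = ∅) : LocalRun P l (s, out)

/-- The history is one of processes that execute the protocol: every process goes through its events
as the protocol prescribes, and only a halting process may leave its last transaction unfinished. -/
structure Executes : Prop where
  run : ∀ P l, l ≠ [] → H.IsSegment P l → ∃ t, LocalRun prot H P l t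
  complete : ∀ P ∉ H.halts, ∀ l, l ≠ [] → H.IsSegment P l → (∀ e ∈ H.eventsAt P, e ∈ l) →
    ∃ s, LocalRun prot H P l (s, [])

end Execution

/-! ## The vacuum loop -/

/-- A packet of the history, or a packet made by the vacuum loop (`stamp` tells apart the multicasts
of the loop). -/
inductive LoopPacket (Proc Pkt C : Type u) where
  | old (k : Pkt)
  | fresh (stamp : ℕ) (c : C) (target : Proc)

/-- An event of the history, or an event appended by the vacuum loop. -/
inductive LoopEvent (Proc Pkt Mc Req C : Type u) where
  | old (e : Event Proc Pkt Mc Req)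
  | queue (m : Multicast Proc C)
  | deq (k : LoopPacket Proc Pkt C)
  | notify (i : ℕ)
  | request (r : Req)

/-- The place in the vacuum loop. -/
inductive LoopStep where
  | undoHalt | finish | requests | packets | selfPackets | nextView | exited

/-- The state of the vacuum loop at a process `P`. -/
structure LoopState (Proc Pkt Mc Req State C : Type u) where
  step : LoopStep
  v : ℕ
  /-- The state of `P`; `none` if `P` is uninitialized. -/
  state : Option State
  /-- The side effects of the current item that have not been carried out yet. -/
  pending : List (Multicast Proc C)
  /-- The request queue of `P`. -/
  requests : Set Req
  /-- The packets in the receive queues of the channels to `P` from other processes. -/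
  inbox : Set Pkt
  /-- The send queues of the channels from `P`, by target, oldest packet first. -/
  sendQueue : Proc → List (LoopPacket Proc Pkt C)
  /-- The receive queues of the channels from `P`, by target, oldest packet first. -/
  recvQueue : Proc → List (LoopPacket Proc Pkt C)
  /-- The event sequence of `P`, newest first. -/
  trace : List (LoopEvent Proc Pkt Mc Req C)

section VacuumLoop

variable {Proc Pkt Mc Req M : Type u} (prot : Protocol Proc M)
  (H : HistoryData Proc Pkt Mc Req prot.Content M) (P : Proc)

/-- The content of a packet. -/
def LoopPacket.content : LoopPacket Proc Pkt prot.Content → prot.Content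
  | .old k => H.content k
  | .fresh _ c _ => c

/-- `l` lists the packets in `S`, all of them on one channel, in the order of queuing. -/
def IsQueueOf (S : Set Pkt) (l : List (LoopPacket Proc Pkt prot.Content)) : Prop :=
  ∃ ks : List Pkt, l = ks.map .old ∧ (∀ k, k ∈ ks ↔ k ∈ S) ∧
    ks.Pairwise (fun k k' => H.lt (H.queueEvent k) (H.queueEvent k'))

/-- The halting state of `P`, from which the vacuum loop starts. -/
structure IsHaltingState (c : LoopState Proc Pkt Mc Req prot.State prot.Content) : Prop where
  step : c.step = .undoHalt
  /-- `v` is the highest view processed by `P`, or the one below the join view. -/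
  v : (.notify c.v P ∈ H.events ∧ ∀ i, .notify i P ∈ H.events → i ≤ c.v) ∨
    (H.eventsAt P = ∅ ∧ c.v + 1 = H.joinView P)
  state : (H.eventsAt P = ∅ ∧ c.state = none ∧ c.pending = [] ∧ c.trace = []) ∨
    ∃ l s, H.IsSegment P l ∧ (∀ e ∈ H.eventsAt P, e ∈ l) ∧ LocalRun prot H P l (s, c.pending) ∧
      c.state = some s ∧ c.trace = l.map .old
  requests : c.requests = {r | H.issuer r = P ∧ .request r ∉ H.events}
  inbox : c.inbox = {k | H.target k = P ∧ H.source k ≠ P ∧ k ∈ H.received ∧ .deq k ∉ H.events}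
  sendQueue : ∀ Q, IsQueueOf prot H {k ∈ H.channel P Q | k ∉ H.sent} (c.sendQueue Q)
  recvQueue : ∀ Q, IsQueueOf prot H {k ∈ H.channel P Q | k ∈ H.received ∧ .deq k ∉ H.events}
    (c.recvQueue Q)

/-- Carry out one multicast.  Upstream packets stay in their send queues (unsent and unreceived);
downstream packets are sent and received, and so go to their receive queues. -/
def LoopState.emit (c : LoopState Proc Pkt Mc Req prot.State prot.Content)
    (m : Multicast Proc prot.Content) (out : List (Multicast Proc prot.Content)) :
    LoopState Proc Pkt Mc Req prot.State prot.Content :=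
  { c with
    pending := out
    sendQueue := fun Q => if Q ∈ m.targets ∧ H.upstream P Q
      then c.sendQueue Q ++ [.fresh c.trace.length m.content Q] else c.sendQueue Q
    recvQueue := fun Q => if Q ∈ m.targets ∧ H.downstream P Q
      then c.recvQueue Q ++ [.fresh c.trace.length m.content Q] else c.recvQueue Q
    trace := if m.targets = ∅ then c.trace else .queue m :: c.trace }

/-- Record the dequeuing event `e` of an item whose processing results in `t`. -/
def LoopState.process (c : LoopState Proc Pkt Mc Req prot.State prot.Content)
    (e : LoopEvent Proc Pkt Mc Req prot.Content)
    (t : prot.State × List (Multicast Proc prot.Content)) :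
    LoopState Proc Pkt Mc Req prot.State prot.Content :=
  { c with state := some t.1, pending := t.2, trace := e :: c.trace }

/-- One step of the vacuum loop.  The side effects of an item are carried out before anything else
happens.  Nothing is assumed on the order in which requests are taken from the request queue, nor on
the interleaving of packets that come from different processes. -/
inductive VacuumStep : LoopState Proc Pkt Mc Req prot.State prot.Content →
    LoopState Proc Pkt Mc Req prot.State prot.Content → Prop
  | undoHalt (c) (i : ℕ) (tr : List (LoopEvent Proc Pkt Mc Req prot.Content))
      (hc : c.step = .undoHalt) (hi : H.removalView P = i)
      (ht : c.trace = .old (.notify i P) :: tr) :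
      VacuumStep c { c with step := .finish, v := i - 1, trace := tr }
  | noHalt (c) (hc : c.step = .undoHalt)
      (ht : ∀ i : ℕ, H.removalView P = i → c.trace.head? ≠ some (.old (.notify i P))) :
      VacuumStep c { c with step := .finish }
  | emit (c) (m : Multicast Proc prot.Content) (out : List (Multicast Proc prot.Content))
      (hc : c.step ≠ .undoHalt) (hp : c.pending = m :: out) :
      VacuumStep c (c.emit prot H P m out)
  | finished (c) (hc : c.step = .finish) (hp : c.pending = []) :
      VacuumStep c { c with step := .requests }
  | request (c) (s : prot.State) (r : Req) (hc : c.step = .requests) (hp : c.pending = [])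
      (hs : c.state = some s) (hv : H.joinView P ≤ c.v) (hr : r ∈ c.requests) :
      VacuumStep c { c.process prot (.request r) (prot.broadcast (H.reqContent r) s) with
        requests := c.requests \ {r} }
  | noRequest (c) (hc : c.step = .requests) (hp : c.pending = [])
      (h : c.v < H.joinView P ∨ c.requests = ∅) : VacuumStep c { c with step := .packets }
  | packet (c) (s : prot.State) (k : Pkt) (hc : c.step = .packets) (hp : c.pending = [])
      (hs : c.state = some s) (hv : H.removalView P = ((c.v + 1 : ℕ) : ℕ∞)) (hk : k ∈ c.inbox)
      (hfirst : ∀ k' ∈ c.inbox, H.source k' = H.source k →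
        ¬ H.lt (H.queueEvent k') (H.queueEvent k)) :
      VacuumStep c { c.process prot (.deq (.old k)) (prot.packet (H.content k) (H.source k) s) with
        inbox := c.inbox \ {k} }
  | noPacket (c) (hc : c.step = .packets) (hp : c.pending = [])
      (h : H.removalView P ≠ ((c.v + 1 : ℕ) : ℕ∞) ∨ c.inbox = ∅) :
      VacuumStep c { c with step := .selfPackets }
  | selfPacket (c) (s : prot.State) (k : LoopPacket Proc Pkt prot.Content)
      (ks : List (LoopPacket Proc Pkt prot.Content)) (hc : c.step = .selfPackets)
      (hp : c.pending = []) (hs : c.state = some s) (hk : c.recvQueue P = k :: ks) :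
      VacuumStep c { c.process prot (.deq k) (prot.packet (k.content prot H) P s) with
        recvQueue := Function.update c.recvQueue P ks }
  | noSelfPacket (c) (hc : c.step = .selfPackets) (hp : c.pending = [])
      (h : c.recvQueue P = []) : VacuumStep c { c with step := .nextView }
  | halt (c) (hc : c.step = .nextView) (hp : c.pending = [])
      (hv : H.removalView P = ((c.v + 1 : ℕ) : ℕ∞)) :
      VacuumStep c { c with step := .exited, v := c.v + 1, trace := .notify (c.v + 1) :: c.trace }
  | fork (c) (l : List (Event Proc Pkt Mc Req)) (s : prot.State) (hc : c.step = .nextView)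
      (hp : c.pending = []) (hv : c.v + 1 = H.joinView P)
      (hs : LocalRun prot H (H.parent P) l (s, []))
      (hl : H.IsSegment (H.parent P) (.notify (H.joinView P) (H.parent P) :: l)) :
      VacuumStep c { c.process prot (.notify (c.v + 1)) (prot.run P s) with
        step := .requests, v := c.v + 1 }
  | notify (c) (s : prot.State) (t : prot.State × List (Multicast Proc prot.Content))
      (hc : c.step = .nextView) (hp : c.pending = []) (hs : c.state = some s)
      (hv : H.removalView P ≠ ((c.v + 1 : ℕ) : ℕ∞))
      (ht : Processes prot H P s (.notify (c.v + 1) P) t) :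
      VacuumStep c { c.process prot (.notify (c.v + 1)) t with step := .requests, v := c.v + 1 }

/-- The vacuum loop at `P` terminates: its starting state exists, and from there it has no infinite
run, while every run that cannot be continued has exited. -/
def VacuumLoopTerminates : Prop :=
  (∃ c, IsHaltingState prot H P c) ∧
  ∀ c, IsHaltingState prot H P c →
    (¬ ∃ run : ℕ → LoopState Proc Pkt Mc Req prot.State prot.Content,
      run 0 = c ∧ ∀ n, VacuumStep prot H P (run n) (run (n + 1))) ∧
    ∀ c', Relation.ReflTransGen (VacuumStep prot H P) c c' →
      (∀ c'', ¬ VacuumStep prot H P c' c'') → c'.step = .exited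

end VacuumLoop

/-- A protocol is vacuum convergent if the vacuum loop terminates at every halting process of every
lossless conforming history of the protocol.  (The vacuum loop at a process that is not original
presupposes that the parent processes the notification that announces the process.) -/
def VacuumConvergent {Proc M : Type u} (prot : Protocol Proc M) : Prop :=
  ∀ (Pkt Mc Req : Type u) (H : HistoryData Proc Pkt Mc Req prot.Content M),
    H.IsHistory → H.IsConforming → H.IsLossless → Executes prot H →
    ∀ P ∈ H.halts,
      (0 < H.joinView P → .notify (H.joinView P) (H.parent P) ∈ H.events) →
      VacuumLoopTerminates prot H P

/-! ## The CBCAST protocol -/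

namespace CBCAST

/-- A message with its metadata: originator, view and vector time. -/
structure Msg (Proc M : Type u) where
  body : M
  orig : Proc
  mview : ℕ
  mvt : Proc → Option ℕ

/-- A counter of broadcast (`b`) and forwarded (`f`) messages. -/
structure Count where
  b : ℕ
  f : ℕ

def Count.total (c : Count) : ℕ := c.b + c.f

/-- A record `⟨msg, index, iset⟩` of a wait set.  Vectors that are indexed by process identifiers are
functions to `Option`, with value `none` where there is no entry. -/
structure WaitRec (Proc M : Type u) where
  msg : Msg Proc M
  index : Count
  iset : Proc → Option Count

/-- The contents of donation and co-donation packets. -/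
structure Donation (Proc M : Type u) where
  waitSet : Finset (WaitRec Proc M)
  mpktIn : Proc → Option Count
  ghostHeight : ℕ
  flushHeight : ℕ

/-- Packet contents. -/
inductive Content (Proc M : Type u) where
  | message (m : Msg Proc M)
  | ack (m : Msg Proc M)
  | ghost (v : ℕ)
  | flush (v : ℕ)
  | donation (d : Donation Proc M)
  | coDonation (d : Donation Proc M)

/-- Pending view changes. -/
inductive ViewChange (Proc : Type u) where
  | join (P : Proc)
  | remove (P : Proc)

/-- The state of a process.  `out` collects the multicasts of the call that is being executed. -/
structure State (Proc M D : Type u) where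
  curView : ℕ
  vGap : ℕ
  self : Proc
  mSet : Finset Proc
  pendViewQueue : List (ViewChange Proc)
  liveSet : Finset Proc
  contactSet : Finset Proc
  vt : Proc → Option ℕ
  receiveSet : Finset (Msg Proc M)
  fwdQueue : Proc → Option (List (Msg Proc M))
  bcastWaitSet : Finset (WaitRec Proc M)
  fwdWaitSet : Finset (WaitRec Proc M)
  launchQueue : List M
  data : D
  ghostHeight : ℕ
  flushHeight : ℕ
  ghost : Proc → Option ℕ
  flush : Proc → Option ℕ
  mpktOut : Count
  mpktIn : Proc → Option Count
  out : List (Multicast Proc (Content Proc M))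

/-- An untimely item in the processing of a donation or co-donation: a record of the local wait set
(`localWS`) or of the donated one (`donated`). -/
inductive Unt (Proc M : Type u) where
  | localWS (w : WaitRec Proc M)
  | donated (w : WaitRec Proc M)

/-- The sorting key `(h₁, h₂)` of untimely items, at the process `self`. -/
def Unt.key {Proc M : Type u} (self : Proc) : Unt Proc M → ℕ ×ₗ ℕ
  | .localWS w => toLex (w.index.total, 0)
  | .donated w => toLex (((w.iset self).elim 0 Count.total), w.index.total)

/-- What the protocol leaves open: the callbacks of the user application that manage the replicated
data, the order in which the elements of a set are visited, and the way in which ties are broken in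
sorting. -/
structure Env (Proc M D : Type u) where
  groundState : D
  applyMessage : M → Proc → D → D
  applyJoin : Proc → D → D
  applyRemoval : Proc → D → D
  enumProc : Finset Proc → List Proc
  enumProc_spec : ∀ s, (enumProc s).Nodup ∧ ∀ p, p ∈ enumProc s ↔ p ∈ s
  enumMsg : Finset (Msg Proc M) → List (Msg Proc M)
  enumMsg_spec : ∀ s, (enumMsg s).Nodup ∧ ∀ m, m ∈ enumMsg s ↔ m ∈ s
  sortUnt : Proc → Finset (Unt Proc M) → List (Unt Proc M)
  sortUnt_spec : ∀ self s, (sortUnt self s).Nodup ∧ (∀ x, x ∈ sortUnt self s ↔ x ∈ s) ∧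
    (sortUnt self s).Pairwise (fun x y => x.key self ≤ y.key self)

section Procedures

variable {Proc M D : Type u} (env : Env Proc M D)

local notation "St" => State Proc M D

/-- The wait set is the union of its two parts. -/
def State.waitSet (s : St) : Finset (WaitRec Proc M) := s.bcastWaitSet ∪ s.fwdWaitSet

/-- Overall height: current view plus view gap. -/
def State.height (s : St) : ℕ := s.curView + s.vGap

/-- Queue (multicast) a packet to a set of processes. -/
def State.queue (s : St) (c : Content Proc M) (T : Finset Proc) : St :=
  { s with out := s.out ++ [⟨c, T⟩] }

/-- `vec[p]` for a vector of numbers. -/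
def val (vec : Proc → Option ℕ) (p : Proc) : ℕ := (vec p).getD 0

/-- `vec[p]` for a vector of counters. -/
def cnt (vec : Proc → Option Count) (p : Proc) : Count := (vec p).getD ⟨0, 0⟩

def checkFlush (s : St) : St :=
  if s.fwdWaitSet ≠ ∅ then s else
    let s₁ : St := if s.ghostHeight < s.height then
      { s with ghostHeight := s.height }.queue (.ghost s.height) s.contactSet else s
    if s₁.bcastWaitSet ≠ ∅ then s₁ else
      if s₁.flushHeight < s₁.height then
        { s₁ with flushHeight := s₁.height }.queue (.flush s₁.height) s₁.contactSet else s₁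

def protBroadcast (m : M) (s : St) : St :=
  if 0 < s.vGap then { s with launchQueue := s.launchQueue ++ [m] } else
    let mpktOut : Count := { s.mpktOut with b := s.mpktOut.b + 1 }
    let vt' := Function.update s.vt s.self
      (some (val s.vt s.self + mpktOut.b - (cnt s.mpktIn s.self).b))
    let msg : Msg Proc M := ⟨m, s.self, s.curView, vt'⟩
    let s₁ : St := { s with mpktOut := mpktOut }.queue (.message msg) s.contactSet
    { s₁ with bcastWaitSet := insert ⟨msg, mpktOut, s.mpktIn⟩ s₁.bcastWaitSet }

/-- Every variable is initialized.  (The application thread, which is launched at the end, has no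
effect on the state.) -/
def protStart (roster : Finset Proc) (pid : Proc) : St where
  curView := 0
  vGap := 0
  self := pid
  mSet := roster
  pendViewQueue := []
  liveSet := roster
  contactSet := roster
  vt := fun p => if p ∈ roster then some 0 else none
  receiveSet := ∅
  fwdQueue := fun p => if p ∈ roster then some [] else none
  bcastWaitSet := ∅
  fwdWaitSet := ∅
  launchQueue := []
  data := (env.enumProc roster).foldl (fun d p => env.applyJoin p d) env.groundState
  ghostHeight := 0
  flushHeight := 0
  ghost := fun p => if p ∈ roster then some 0 else none
  flush := fun p => if p ∈ roster then some 0 else none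
  mpktOut := ⟨0, 0⟩
  mpktIn := fun p => if p ∈ roster then some ⟨0, 0⟩ else none
  out := []

def protRun (pid : Proc) (s : St) : St :=
  let mpktOut : Count := { s.mpktOut with b := 0 }
  checkFlush
    { s with
      vGap := s.vGap + 1
      pendViewQueue := s.pendViewQueue ++ [.join pid]
      liveSet := insert pid s.liveSet
      contactSet := {pid}
      fwdQueue := Function.update s.fwdQueue pid (some [])
      bcastWaitSet := ∅
      fwdWaitSet := s.fwdWaitSet.image fun w => { w with index := { w.index with b := 0 } }
      launchQueue := []
      flushHeight := s.ghostHeight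
      ghost := Function.update s.ghost pid (some s.ghostHeight)
      flush := Function.update s.flush pid (some s.ghostHeight)
      mpktOut := mpktOut
      mpktIn := Function.update s.mpktIn pid (some mpktOut)
      self := pid }

/-- Discard the entry of `p` from the instability sets of those records of `W` that satisfy `sel`,
and remove the records whose instability sets thereby become empty. -/
def discard (sel : WaitRec Proc M → Prop) (p : Proc) (W : Finset (WaitRec Proc M)) :
    Finset (WaitRec Proc M) :=
  (W.image fun w => if sel w then { w with iset := Function.update w.iset p none } else w).filter
    fun w => ¬ (sel w ∧ ∀ q, w.iset q = none)

/-- Forward one message of the forwarding queue of a removed process. -/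
def forward (s : St) (msg : Msg Proc M) : St :=
  let mpktOut : Count := { s.mpktOut with f := s.mpktOut.f + 1 }
  let s₁ : St := { s with mpktOut := mpktOut }.queue (.message msg) s.contactSet
  { s₁ with fwdWaitSet := insert ⟨msg, mpktOut, s.mpktIn⟩ s₁.fwdWaitSet }

def protRemove (R : Proc) (s : St) : St :=
  let s₁ : St := { s with
    vGap := s.vGap + 1
    pendViewQueue := s.pendViewQueue ++ [.remove R]
    liveSet := s.liveSet.erase R
    contactSet := s.contactSet.erase R
    bcastWaitSet := discard (fun _ => True) R s.bcastWaitSet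
    fwdWaitSet := discard (fun _ => True) R s.fwdWaitSet
    mpktIn := Function.update s.mpktIn R none }
  let s₂ : St := ((s.fwdQueue R).getD []).foldl forward s₁
  checkFlush
    { s₂ with
      fwdQueue := Function.update s₂.fwdQueue R none
      ghost := Function.update s₂.ghost R none
      flush := Function.update s₂.flush R none }

/-- Give the joining process `J` the instability entry that it inherits from its parent `E`. -/
def inheritEntry (J E : Proc) (w : WaitRec Proc M) : WaitRec Proc M :=
  match w.iset E with
  | some c => { w with iset := Function.update w.iset J (some ⟨0, c.f⟩) }
  | none => w

/-- The donation (or co-donation) of the current state. -/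
def State.donation (s : St) : Donation Proc M := ⟨s.waitSet, s.mpktIn, s.ghostHeight, s.flushHeight⟩

def protJoin (J E : Proc) (s : St) : St :=
  let s₁ : St := { s with
    vGap := s.vGap + 1
    pendViewQueue := s.pendViewQueue ++ [.join J]
    liveSet := insert J s.liveSet
    contactSet := insert J s.contactSet
    fwdQueue := Function.update s.fwdQueue J (some [])
    bcastWaitSet := s.bcastWaitSet.image (inheritEntry J E)
    fwdWaitSet := s.fwdWaitSet.image (inheritEntry J E)
    ghost := Function.update s.ghost J (s.ghost E)
    flush := Function.update s.flush J (s.ghost E)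
    mpktIn := Function.update s.mpktIn J ((s.mpktIn E).map fun c => ⟨0, c.f⟩) }
  checkFlush (s₁.queue (.donation s₁.donation) {J})

/-- A message is deliverable: it belongs to the current view, it is the next one from its originator,
and all the messages on which it depends have been delivered. -/
def deliverable (s : St) (msg : Msg Proc M) : Prop :=
  msg.mview = s.curView ∧ val msg.mvt msg.orig = val s.vt msg.orig + 1 ∧
    ∀ p ∈ s.mSet, p ≠ msg.orig → val msg.mvt p ≤ val s.vt p

/-- Deliver the message if it is deliverable. -/
def scanOne (s : St) (msg : Msg Proc M) : St :=
  if deliverable s msg then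
    { s with
      vt := Function.update s.vt msg.orig ((s.vt msg.orig).map (· + 1))
      receiveSet := s.receiveSet.erase msg
      data := env.applyMessage msg.body msg.orig s.data }
  else s

def scanPass (s : St) : St := (env.enumMsg s.receiveSet).foldl (scanOne env) s

/-- `Scan()`: passes are repeated as long as messages are delivered.  Every such pass makes the
receive set smaller, and a pass without a delivery changes nothing, so the number of passes can be
fixed in advance. -/
def scan (s : St) : St := (scanPass env)^[s.receiveSet.card] s

/-- Install the next pending view. -/
def installNext (s : St) : St :=
  let s₁ : St := { s with
    receiveSet := s.receiveSet.filter fun m => m.mview ≠ s.curView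
    fwdQueue := fun p => if p ∈ s.liveSet then
      (s.fwdQueue p).map (fun q => q.filter fun m => m.mview ≠ s.curView) else s.fwdQueue p
    curView := s.curView + 1
    vGap := s.vGap - 1
    pendViewQueue := s.pendViewQueue.tail }
  let s₂ : St := match s.pendViewQueue with
    | .join p :: _ => { s₁ with mSet := insert p s₁.mSet, data := env.applyJoin p s₁.data }
    | .remove p :: _ => { s₁ with mSet := s₁.mSet.erase p, data := env.applyRemoval p s₁.data }
    | [] => s₁
  scan env { s₂ with vt := fun p => if p ∈ s₂.mSet then some 0 else none }

def tryToInstall (s : St) : St :=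
  if ∃ p ∈ s.liveSet, val s.flush p < s.height then s else
    let s₁ := (installNext env)^[s.vGap] s
    s₁.launchQueue.foldl (fun s m => protBroadcast m s) { s₁ with launchQueue := [] }

def receiveMessage (msg : Msg Proc M) (sender : Proc) (s : St) : St :=
  let s₁ := s.queue (.ack msg) {sender}
  let s₂ : St := { s₁ with
    mpktIn := Function.update s₁.mpktIn sender ((s₁.mpktIn sender).map fun c =>
      if msg.orig = sender then { c with b := c.b + 1 } else { c with f := c.f + 1 }) }
  if msg.mview < s₂.curView then s₂
  else if msg.mview = s₂.curView ∧ val msg.mvt msg.orig ≤ val s₂.vt msg.orig then s₂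
  else if msg ∈ s₂.receiveSet then s₂
  else scan env
    { s₂ with
      receiveSet := insert msg s₂.receiveSet
      fwdQueue := Function.update s₂.fwdQueue sender
        ((s₂.fwdQueue sender).map fun q => q ++ [msg]) }

def receiveAck (msg : Msg Proc M) (sender : Proc) (s : St) : St :=
  let s₁ : St := { s with
    bcastWaitSet := discard (fun w => w.msg = msg) sender s.bcastWaitSet
    fwdWaitSet := discard (fun w => w.msg = msg) sender s.fwdWaitSet }
  -- some record of the message has become stable
  if ∃ w ∈ s.waitSet, w.msg = msg ∧ ∀ q, Function.update w.iset sender none q = none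
  then checkFlush s₁ else s₁

def receiveGhost (v : ℕ) (sender : Proc) (s : St) : St :=
  { s with ghost := Function.update s.ghost sender (some v) }

def receiveFlush (v : ℕ) (sender : Proc) (s : St) : St :=
  tryToInstall env { s with flush := Function.update s.flush sender (some v) }

/-- Process one untimely item found in the donation or co-donation `d`. -/
def receiveUnt (d : Donation Proc M) (sender : Proc) (s : St) : Unt Proc M → St
  | .donated w =>
    if (cnt s.mpktIn sender).total < w.index.total then receiveMessage env w.msg sender s else s
  | .localWS w =>
    if w.index.total ≤ (cnt d.mpktIn s.self).total then receiveAck w.msg sender s else s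

/-- The common part of the processing of donations and co-donations. -/
def receiveUnts (d : Donation Proc M) (sender : Proc) (s : St) : St :=
  let unt : Finset (Unt Proc M) :=
    (s.waitSet.filter fun w => (w.iset sender).isSome).image .localWS ∪
      (d.waitSet.filter fun w => (w.iset s.self).isSome).image .donated
  let s₁ := (env.sortUnt s.self unt).foldl (receiveUnt env d sender) s
  { s₁ with
    ghost := Function.update s₁.ghost sender (some d.ghostHeight)
    flush := Function.update s₁.flush sender (some d.flushHeight) }

def receiveDonation (d : Donation Proc M) (sender : Proc) (s : St) : St :=
  let s₁ : St := { s with contactSet := insert sender s.contactSet }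
  receiveUnts env d sender (s₁.queue (.coDonation s₁.donation) {sender})

def receiveCoDonation (d : Donation Proc M) (sender : Proc) (s : St) : St :=
  tryToInstall env (receiveUnts env d sender s)

def protPacket (c : Content Proc M) (sender : Proc) (s : St) : St :=
  match c with
  | .message msg => receiveMessage env msg sender s
  | .ack msg => receiveAck msg sender s
  | .ghost v => receiveGhost v sender s
  | .flush v => receiveFlush env v sender s
  | .donation d => receiveDonation env d sender s
  | .coDonation d => receiveCoDonation env d sender s

/-- Execute a procedure, starting with no side effects, and return them with the new state. -/
def call (f : St → St) (s : St) : St × List (Multicast Proc (Content Proc M)) :=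
  let s' := f { s with out := [] }
  (s', s'.out)

/-- The CBCAST protocol. -/
def protocol : Protocol Proc M where
  State := State Proc M D
  Content := Content Proc M
  start := fun roster P => (protStart env roster P, [])
  run := fun P => call (protRun P)
  remove := fun R => call (protRemove R)
  join := fun J E => call (protJoin J E)
  packet := fun c S => call (protPacket env c S)
  broadcast := fun m => call (protBroadcast m)

end Procedures

end CBCAST

end

/-!
The vacuum loop consumes three kinds of items: requests and packets from other processes, of which
there are finitely many; view notifications, of which there are finitely many as well, since a
halting process of a conforming history has a finite removal view; and the packets that the process
sends to itself. Only the last kind can be produced by the loop, so that termination is a question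
about the calls of the protocol for packets. By `vacuumConvergent_of_potential` it is enough to
bound the packets caused by a packet: each content has a rank and a weight and each state has a
credit such that the side effects of a packet have together smaller rank than the packet, or not
greater rank and, counting the change of credit, smaller weight. The loop then decreases a
lexicographic measure (`LoopInvariant.progress_lt`).

That the packets from other processes are finite in number uses losslessness
(`HistoryData.IsHistory.finite_inbox`): the undequeued ones belong to downstream channels, whose
sources either halt or learn of the removal of the process and then stop sending to it. The loop
does not get stuck before the exit (`LoopInvariant.exists_step`) because the state of the process is
initialized whenever it is needed, and because every view change is announced to the members.

In CBCAST (`CBCAST.protPacket_decreases`) a donation causes a co-donation, and otherwise both cause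
only packets of rank zero. A message causes an acknowledgement. Ghost and flush packets are sent at
most once for each height, and no packet changes the height, because the installation of a view
increases the current view and decreases the gap. Finally, a flush packet (or co-donation) can
launch the messages of the launch queue, which it thereby empties. So the credit of a state consists
of the ghost and flush packets that are due at its height and of its launch queue.
-/

noncomputable section

open scoped Classical

/-! ### Weights of side effects -/

/-- The total weight of a list of multicasts, where `w` is the weight of a packet content. -/
def effectWeight {Proc C : Type u} (w : C → ℕ) (out : List (Multicast Proc C)) : ℕ :=
  (out.map fun m => w m.content).sum

section EffectWeight

variable {Proc C : Type u} (w : C → ℕ)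

@[simp] theorem effectWeight_nil : effectWeight w ([] : List (Multicast Proc C)) = 0 := rfl

@[simp] theorem effectWeight_cons (m : Multicast Proc C) (out : List (Multicast Proc C)) :
    effectWeight w (m :: out) = w m.content + effectWeight w out := by
  simp [effectWeight]

@[simp] theorem effectWeight_append (out out' : List (Multicast Proc C)) :
    effectWeight w (out ++ out') = effectWeight w out + effectWeight w out' := by
  simp [effectWeight]

end EffectWeight

/-! ### Finite sets as sorted lists -/

/-- A finite set on which a transitive relation compares any two elements can be listed along the
relation. -/
theorem exists_pairwise_list {α : Type*} {r : α → α → Prop}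
    (htrans : ∀ a b c, r a b → r b c → r a c) {S : Set α} (hS : S.Finite)
    (htotal : ∀ a ∈ S, ∀ b ∈ S, a ≠ b → r a b ∨ r b a) :
    ∃ l : List α, (∀ a, a ∈ l ↔ a ∈ S) ∧ l.Pairwise r := by
  induction S, hS using Set.Finite.induction_on with
  | empty => exact ⟨[], by simp, List.Pairwise.nil⟩
  | @insert a S ha _ ih =>
    obtain ⟨l, hl, hp⟩ := ih fun x hx y hy => htotal x (.inr hx) y (.inr hy)
    refine ⟨l.filter (fun x => r x a) ++ a :: l.filter (fun x => ¬ r x a), fun x => ?_, ?_⟩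
    · simp only [List.mem_append, List.mem_filter, List.mem_cons, hl, decide_eq_true_eq,
        Set.mem_insert_iff]
      tauto
    · have hr : ∀ x ∈ l, ¬ r x a → r a x := fun x hx hxa =>
        (htotal x (.inr ((hl x).1 hx)) a (.inl rfl)
          (fun h => ha (h ▸ (hl x).1 hx))).resolve_left hxa
      refine List.pairwise_append.2 ⟨hp.filter _, List.pairwise_cons.2 ⟨?_, hp.filter _⟩, ?_⟩
      · intro x hx
        simp only [List.mem_filter, decide_eq_true_eq] at hx
        exact hr x hx.1 hx.2
      · intro x hx y hy
        simp only [List.mem_filter, List.mem_cons, decide_eq_true_eq] at hx hy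
        rcases hy with rfl | hy
        · exact hx.2
        · exact htrans x a y hx.2 (hr y hy.1 hy.2)

/-! ### Histories -/

namespace HistoryData

variable {Proc Pkt Mc Req C M : Type u} {H : HistoryData Proc Pkt Mc Req C M}

theorem Notifies.bounds (hH : H.IsHistory) {i : ℕ} {P : Proc} {c : Notification Proc}
    (h : H.Notifies i P c) : H.joinView P ≤ i ∧ (i : ℕ∞) ≤ H.removalView P := by
  have hP := (hH.view_interval P).1
  cases h with
  | join _ _ J h₁ h₂ _ => exact ⟨h₁.le, h₂.le⟩
  | remove _ _ R h₁ h₂ _ => exact ⟨h₁.le, h₂.le⟩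
  | new => exact ⟨le_rfl, hP.le⟩
  | dead _ _ h₁ _ => exact ⟨by rw [h₁] at hP; exact_mod_cast hP.le, h₁.ge⟩

theorem IsHistory.notify_bounds (hH : H.IsHistory) {i : ℕ} {P : Proc}
    (h : .notify i P ∈ H.events) : H.joinView P ≤ i ∧ (i : ℕ∞) ≤ H.removalView P :=
  (hH.notify_exists i P h).elim fun _ hc => hc.bounds hH

theorem IsHistory.mem_view_iff (hH : H.IsHistory) {i : ℕ} (hi : (i : ℕ∞) < H.numViews) (P : Proc) :
    P ∈ H.view i ↔ H.joinView P ≤ i ∧ (i : ℕ∞) < H.removalView P := by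
  have h := Set.ext_iff.1 (hH.view_interval P).2 i
  simpa [hi] using h

theorem IsHistory.lt_numViews (hH : H.IsHistory) {i : ℕ} {P : Proc} (h₁ : H.joinView P ≤ i)
    (h₂ : (i : ℕ∞) < H.removalView P) : (i : ℕ∞) < H.numViews := by
  have h : i ∈ {i : ℕ | (i : ℕ∞) < H.numViews ∧ P ∈ H.view i} := by
    rw [(hH.view_interval P).2]
    exact ⟨h₁, h₂⟩
  exact h.1

theorem IsHistory.lt_trans (hH : H.IsHistory) {e f g : Event Proc Pkt Mc Req} (h : H.lt e f)
    (h' : H.lt f g) : H.lt e g := by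
  have tr : ∀ {a b c}, H.le a b → H.le b c → H.le a c := fun hab hbc => by
    rw [hH.minimal_order] at hab hbc ⊢
    exact ⟨hab.1, hbc.2.1, hab.2.2.trans hbc.2.2⟩
  exact ⟨tr h.1 h'.1, fun hge => h.2 (tr h'.1 hge)⟩

theorem lt_irrefl (e : Event Proc Pkt Mc Req) : ¬ H.lt e e := fun h => h.2 h.1

theorem IsHistory.queueEvent_mem (hH : H.IsHistory) (k : Pkt) :
    H.queueEvent k ∈ H.eventsAt (H.source k) := ⟨hH.queue_mem k, .inl ⟨k, rfl, rfl⟩⟩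

theorem notify_mem_eventsAt {i : ℕ} {P : Proc} (h : .notify i P ∈ H.events) :
    .notify i P ∈ H.eventsAt P := ⟨h, .inr (.inr (.inl ⟨i, rfl⟩))⟩

/-- Every view change inside the view interval of a process is announced to it. -/
theorem IsHistory.exists_change (hH : H.IsHistory) {v : ℕ} {P : Proc} (h₁ : H.joinView P ≤ v)
    (h₂ : ((v + 1 : ℕ) : ℕ∞) < H.removalView P) :
    (∃ J, H.Notifies (v + 1) P (.joined J (H.parent J))) ∨
      ∃ R, H.Notifies (v + 1) P (.removed R) := by
  have hn := hH.lt_numViews (by omega) h₂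
  have hn' : (v : ℕ∞) < H.numViews := lt_of_le_of_lt (by exact_mod_cast Nat.le_succ v) hn
  rcases hH.view_change v hn with ⟨Q, hQ, hv⟩ | ⟨Q, hQ, hv⟩
  · left
    have hQ' : Q ∈ H.view (v + 1) := hv ▸ Finset.mem_insert_self _ _
    rw [hH.mem_view_iff hn] at hQ'
    rw [hH.mem_view_iff hn'] at hQ
    have : (v : ℕ∞) < H.removalView Q := lt_of_le_of_lt (by exact_mod_cast Nat.le_succ v) hQ'.2
    have : ¬ H.joinView Q ≤ v := fun h => hQ ⟨h, this⟩
    exact ⟨Q, .join _ _ _ (by omega) h₂ (by omega)⟩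
  · right
    have hQ' : Q ∉ H.view (v + 1) := by simp [hv]
    rw [hH.mem_view_iff hn] at hQ'
    rw [hH.mem_view_iff hn'] at hQ
    refine ⟨Q, .remove _ _ _ (by omega) h₂ (le_antisymm ?_ ?_)⟩
    · by_contra hlt
      exact hQ' ⟨by omega, not_le.1 hlt⟩
    · simpa using Order.add_one_le_of_lt hQ.2

/-- Finitely many queuing events come from finitely many packets. -/
theorem IsHistory.finite_packets (hH : H.IsHistory) {S : Set (Event Proc Pkt Mc Req)}
    (hS : S.Finite) {T : Set Pkt} (hT : ∀ k ∈ T, H.queueEvent k ∈ S) : T.Finite := by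
  refine (hS.preimage' (f := H.queueEvent) fun b _ => ?_).subset hT
  rcases b with x | _ | _ | _
  · refine (hH.multicast_finite x).subset fun k hk => ?_
    simpa [queueEvent] using hk
  all_goals exact Set.finite_empty.subset fun k hk => by simp [queueEvent] at hk

theorem IsHistory.finite_packets_of_halts (hH : H.IsHistory) {P : Proc} (hP : P ∈ H.halts) :
    {k | H.source k = P}.Finite :=
  hH.finite_packets (hH.halt_finite P hP) fun k hk => hk ▸ hH.queueEvent_mem k

/-- The packets of one channel are linearly ordered by their queuing events. -/
theorem IsHistory.channel_total (hH : H.IsHistory) {P Q : Proc} {k k' : Pkt}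
    (hk : k ∈ H.channel P Q) (hk' : k' ∈ H.channel P Q) (hne : k ≠ k') :
    H.lt (H.queueEvent k) (H.queueEvent k') ∨ H.lt (H.queueEvent k') (H.queueEvent k) := by
  refine hH.process_order P _ (hk.1 ▸ hH.queueEvent_mem k) _ (hk'.1 ▸ hH.queueEvent_mem k') ?_
  intro h
  refine hne (hH.multicast_target k k' ?_ (hk.2.trans hk'.2.symm))
  simpa [queueEvent] using h

/-- Only finitely many received packets are left undequeued at a halting process.  Their channels
are downstream, so their sources outlive the process in the views.  A source that halts has only
finitely many events; any other one learns of the removal of the process, after which it does not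
queue packets to it. -/
theorem IsHistory.finite_inbox (hH : H.IsHistory) (hL : H.IsLossless) {P : Proc}
    {n : ℕ} (hn : H.removalView P = n) :
    {k | H.target k = P ∧ H.source k ≠ P ∧ k ∈ H.received ∧ .deq k ∉ H.events}.Finite := by
  set S := {k | H.target k = P ∧ H.source k ≠ P ∧ k ∈ H.received ∧ .deq k ∉ H.events}
  have hout : ∀ k ∈ S, (n : ℕ∞) < H.removalView (H.source k) := by
    rintro k ⟨rfl, hne, hrec, hdeq⟩
    by_contra h
    exact hdeq (hL.upstream k ⟨hn ▸ not_lt.1 h, hne⟩ hrec)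
  have hin : ∀ k ∈ S, H.joinView (H.source k) < n := by
    rintro k ⟨rfl, -, -, -⟩
    have hj := (hH.view_interval (H.target k)).1
    rw [hn] at hj
    rcases (hH.process_liveness k).1 with h | ⟨h, -⟩
    · rw [hH.mem_view_iff (hH.lt_numViews le_rfl (hH.view_interval _).1), hn] at h
      exact_mod_cast h.2
    · have hj' : H.joinView (H.target k) < n := by exact_mod_cast hj
      have := (hH.notify_bounds h).1
      omega
  have hT : (⋃ i ∈ Finset.range n, (H.view i : Set Proc)).Finite :=
    (Finset.range n).finite_toSet.biUnion fun i _ => (H.view i).finite_toSet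
  refine (hT.biUnion (t := fun Q => {k ∈ S | H.source k = Q}) fun Q _ => ?_).subset fun k hk => ?_
  · by_cases hQ : Q ∈ H.halts
    · exact (hH.finite_packets_of_halts hQ).subset fun k hk => hk.2
    · rcases Set.eq_empty_or_nonempty {k ∈ S | H.source k = Q} with h | ⟨k₀, hk₀, rfl⟩
      · rw [h]
        exact Set.finite_empty
      · have hev := hH.halt_notify _ hQ n ⟨_, .remove n _ P (hin k₀ hk₀) (hout k₀ hk₀) hn⟩
          fun i' _ => hL.notifications _ _
        refine hH.finite_packets (hH.order_foundation _ _ (notify_mem_eventsAt hev))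
          fun k hk => ⟨hk.2 ▸ hH.queueEvent_mem k, ?_⟩
        have := (hH.process_liveness k).2 n (by rw [hk.1.1, hn])
        rw [hk.2] at this
        exact this hev
  · simp only [Set.mem_iUnion]
    refine ⟨H.source k, ⟨H.joinView (H.source k), Finset.mem_range.2 (hin k hk), ?_⟩, hk, rfl⟩
    exact (hH.mem_view_iff (hH.lt_numViews le_rfl (hH.view_interval _).1) _).2
      ⟨le_rfl, (hH.view_interval _).1⟩

/-- The events of a finite set at one process can be listed with the newest event first. -/
theorem IsHistory.exists_list (hH : H.IsHistory) {P : Proc} {S : Set (Event Proc Pkt Mc Req)}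
    (hS : S.Finite) (hP : S ⊆ H.eventsAt P) :
    ∃ l : List (Event Proc Pkt Mc Req), (∀ e, e ∈ l ↔ e ∈ S) ∧ l.Pairwise fun e f => H.lt f e :=
  exists_pairwise_list (r := fun e f => H.lt f e) (fun _ _ _ h h' => hH.lt_trans h' h) hS
    fun e he f hf hne => (hH.process_order P e (hP he) f (hP hf) hne).symm

/-- The events up to a given event form a segment. -/
theorem IsHistory.exists_segment (hH : H.IsHistory) {P : Proc} {e : Event Proc Pkt Mc Req}
    (he : e ∈ H.eventsAt P) : ∃ l, H.IsSegment P (e :: l) := by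
  obtain ⟨l, hl, hp⟩ := hH.exists_list (hH.order_foundation P e he) fun f hf => hf.1
  refine ⟨l, List.pairwise_cons.2 ⟨fun f hf => ((hl f).1 hf).2, hp⟩, ?_, ?_⟩
  · rintro f hf
    rcases List.mem_cons.1 hf with rfl | hf
    · exact he
    · exact ((hl f).1 hf).1
  · intro f hf g hg hgf
    refine List.mem_cons_of_mem _ ((hl g).2 ⟨hg, ?_⟩)
    rcases List.mem_cons.1 hf with rfl | hf
    · exact hgf
    · exact hH.lt_trans hgf ((hl f).1 hf).2

end HistoryData

section Execution

variable {Proc Pkt Mc Req M : Type u} {prot : Protocol Proc M}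
  {H : HistoryData Proc Pkt Mc Req prot.Content M}

/-- Before a notification other than the first event of a process, the preceding transaction is
complete. -/
theorem LocalRun.before_notify {P Q : Proc} {i : ℕ} {l : List (Event Proc Pkt Mc Req)}
    {t : prot.State × List (Multicast Proc prot.Content)}
    (h : LocalRun prot H P (.notify i Q :: l) t) (hl : l ≠ []) :
    ∃ s, LocalRun prot H P l (s, []) := by
  generalize hL : Event.notify i Q :: l = L at h
  induction h with
  | start | fork => simp_all
  | trigger P l' s e t hs ht => exact ⟨s, by simp_all⟩
  | effect => simp at hL
  | skip P l' s m out hs hm ih => exact ih hL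

/-- If the parent of a joining process dequeues the notification of the join, then the state that
the child inherits is defined. -/
theorem Executes.exists_parent_run (hE : Executes prot H) (hH : H.IsHistory) {P : Proc}
    (hj : 0 < H.joinView P) (hP : .notify (H.joinView P) (H.parent P) ∈ H.events) :
    ∃ l s, LocalRun prot H (H.parent P) l (s, []) ∧
      H.IsSegment (H.parent P) (.notify (H.joinView P) (H.parent P) :: l) := by
  have he := HistoryData.notify_mem_eventsAt hP
  obtain ⟨l, hl⟩ := hH.exists_segment he
  obtain ⟨t, ht⟩ := hE.run _ _ (List.cons_ne_nil _ _) hl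
  -- the parent is a member of an earlier view, so that this is not its first event
  have hne : l ≠ [] := by
    have hlt : ((H.joinView P - 1 : ℕ) : ℕ∞) < H.numViews :=
      lt_of_le_of_lt (by exact_mod_cast Nat.sub_le _ _)
        (hH.lt_numViews le_rfl (hH.view_interval P).1)
    have hv := ((hH.mem_view_iff hlt _).1 (hH.parent_member P hj)).1
    have hb := hH.notify_order (H.parent P) _ (H.joinView P) le_rfl (by omega)
      (hH.notify_bounds hP).2 hP
    have := hl.2.2 _ List.mem_cons_self _ (HistoryData.notify_mem_eventsAt hb.1) hb.2
    rintro rfl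
    simp only [List.mem_singleton, Event.notify.injEq, and_true] at this
    omega
  obtain ⟨s, hs⟩ := ht.before_notify hne
  exact ⟨l, s, hs, hl⟩

end Execution

/-! ### The vacuum loop -/

section VacuumLoop

variable {Proc Pkt Mc Req M : Type u} {prot : Protocol Proc M}
  {H : HistoryData Proc Pkt Mc Req prot.Content M} {P : Proc}

local notation "Loop" => LoopState Proc Pkt Mc Req prot.State prot.Content

/-- The halting state of a halting process is well defined. -/
theorem exists_isHaltingState (hH : H.IsHistory) (hE : Executes prot H) (hP : P ∈ H.halts) {n : ℕ}
    (hn : H.removalView P = n) : ∃ c, IsHaltingState prot H P c := by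
  have hqueue : ∀ (Q : Proc) (S : Set Pkt), S ⊆ H.channel P Q → ∃ l, IsQueueOf prot H S l := by
    intro Q S hS
    have hfin : S.Finite := (hH.finite_packets_of_halts hP).subset fun k hk => (hS hk).1
    obtain ⟨l, hl, hp⟩ := exists_pairwise_list
      (r := fun k k' => H.lt (H.queueEvent k) (H.queueEvent k'))
      (fun _ _ _ h h' => hH.lt_trans h h') hfin
      fun k hk k' hk' hne => hH.channel_total (hS hk) (hS hk') hne
    exact ⟨_, l, rfl, hl, hp⟩
  choose sq hsq using fun Q => hqueue Q {k ∈ H.channel P Q | k ∉ H.sent} fun k hk => hk.1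
  choose rq hrq using fun Q => hqueue Q
    {k ∈ H.channel P Q | k ∈ H.received ∧ .deq k ∉ H.events} fun k hk => hk.1
  suffices h : ∃ (v : ℕ) (state : Option prot.State) (pending : List (Multicast Proc prot.Content))
      (trace : List (LoopEvent Proc Pkt Mc Req prot.Content)),
      ((.notify v P ∈ H.events ∧ ∀ i, .notify i P ∈ H.events → i ≤ v) ∨
        (H.eventsAt P = ∅ ∧ v + 1 = H.joinView P)) ∧
      ((H.eventsAt P = ∅ ∧ state = none ∧ pending = [] ∧ trace = []) ∨
        ∃ l s, H.IsSegment P l ∧ (∀ e ∈ H.eventsAt P, e ∈ l) ∧ LocalRun prot H P l (s, pending) ∧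
          state = some s ∧ trace = l.map .old) by
    obtain ⟨v, state, pending, trace, hv, hs⟩ := h
    exact ⟨{
      step := .undoHalt
      v := v
      state := state
      pending := pending
      requests := {r | H.issuer r = P ∧ .request r ∉ H.events}
      inbox := {k | H.target k = P ∧ H.source k ≠ P ∧ k ∈ H.received ∧ .deq k ∉ H.events}
      sendQueue := sq
      recvQueue := rq
      trace := trace }, rfl, hv, hs, rfl, rfl, hsq, hrq⟩
  rcases Set.eq_empty_or_nonempty (H.eventsAt P) with h0 | h1
  · -- an original process has at least the event for view zero
    have hj : H.joinView P ≠ 0 := fun hj =>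
      (h0 ▸ HistoryData.notify_mem_eventsAt (hH.notify_zero P hj) : _ ∈ (∅ : Set _)).elim
    exact ⟨H.joinView P - 1, none, [], [], .inr ⟨h0, by omega⟩, .inl ⟨h0, rfl, rfl, rfl⟩⟩
  · have hfirst := (hH.first_event P h1).1
    set S := {i | Event.notify i P ∈ H.events}
    have hb : BddAbove S := ⟨n, fun i hi => by
      have := (hH.notify_bounds hi).2
      rw [hn] at this
      exact_mod_cast this⟩
    obtain ⟨l, hl, hp⟩ := hH.exists_list (hH.halt_finite P hP) subset_rfl
    have hseg : H.IsSegment P l := ⟨hp, fun e he => (hl e).1 he, fun e _ f hf _ => (hl f).2 hf⟩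
    have hne : l ≠ [] :=
      List.ne_nil_of_mem ((hl _).2 (HistoryData.notify_mem_eventsAt hfirst))
    obtain ⟨⟨s, out⟩, hrun⟩ := hE.run P l hne hseg
    exact ⟨sSup S, some s, out, _, .inl ⟨Nat.sSup_mem ⟨_, hfirst⟩ hb, fun i hi => le_csSup hb hi⟩,
      .inr ⟨l, s, hseg, fun e he => (hl e).2 he, hrun, rfl, rfl⟩⟩

variable (H P) in
/-- The invariant of the vacuum loop at a process that is a member of the views below `n`. -/
structure LoopInvariant (n : ℕ) (c : Loop) : Prop where
  requests : c.requests.Finite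
  inbox : c.inbox.Finite
  joinView_le : H.joinView P ≤ c.v + 1
  initialized : H.joinView P ≤ c.v → c.state ≠ none
  uninitialized : c.state = none →
    c.pending = [] ∧ c.recvQueue P = [] ∧ (c.step = .undoHalt → c.trace = [])
  view_lt : c.step ≠ .undoHalt → c.step ≠ .exited → c.v < n
  undo : c.step = .undoHalt → c.v < n ∨ ∃ tr, c.trace = .old (.notify n P) :: tr

theorem IsHaltingState.invariant (hH : H.IsHistory) (hL : H.IsLossless) (hP : P ∈ H.halts) {n : ℕ}
    (hn : H.removalView P = n) {c : Loop} (hc : IsHaltingState prot H P c) :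
    LoopInvariant H P n c := by
  have hj := (hH.view_interval P).1
  rw [hn] at hj
  have hj' : H.joinView P < n := by exact_mod_cast hj
  refine ⟨?_, ?_, ?_, ?_, ?_, fun h => absurd hc.step h, fun _ => ?_⟩
  · rw [hc.requests]
    exact (hH.halt_requests P hP).subset fun r hr => hr.1
  · rw [hc.inbox]
    exact hH.finite_inbox hL hn
  · rcases hc.v with ⟨h, -⟩ | ⟨-, h⟩
    · have := (hH.notify_bounds h).1
      omega
    · omega
  · rintro hv hs
    rcases hc.state with ⟨h0, -⟩ | ⟨l, s, -, -, -, h, -⟩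
    · rcases hc.v with ⟨h, -⟩ | ⟨-, h⟩
      · exact (h0 ▸ HistoryData.notify_mem_eventsAt h : _ ∈ (∅ : Set _)).elim
      · omega
    · simp [h] at hs
  · intro hs
    rcases hc.state with ⟨h0, -, hp, ht⟩ | ⟨l, s, -, -, -, h, -⟩
    · refine ⟨hp, ?_, fun _ => ht⟩
      obtain ⟨ks, hks, hmem, -⟩ := hc.recvQueue P
      rcases ks with _ | ⟨k, ks⟩
      · exact hks
      · have hk := ((hmem k).1 List.mem_cons_self).1.1
        have := hH.queueEvent_mem k
        rw [hk, h0] at this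
        exact this.elim
    · simp [h] at hs
  · rcases hc.v with ⟨h, -⟩ | ⟨-, h⟩
    · rcases (show c.v ≤ n by
        have := (hH.notify_bounds h).2
        rw [hn] at this
        exact_mod_cast this).lt_or_eq with hlt | rfl
      · exact .inl hlt
      · right
        have he := HistoryData.notify_mem_eventsAt h
        rcases hc.state with ⟨h0, -⟩ | ⟨l, s, hl, hmem, -, -, ht⟩
        · exact (h0 ▸ he : _ ∈ (∅ : Set _)).elim
        · have hel := hmem _ he
          rcases l with _ | ⟨e, l⟩
          · simp at hel
          · -- the final notification is the last event, and thus the head of the trace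
            rcases List.mem_cons.1 hel with rfl | hel
            · exact ⟨_, ht⟩
            · exact ((List.pairwise_cons.1 hl.1).1 _ hel).2.elim
                (hH.last_event P _ hn h e (hl.2.1 e List.mem_cons_self))
    · left
      omega

theorem LoopInvariant.step (hH : H.IsHistory) {n : ℕ} (hn : H.removalView P = n) {c c' : Loop}
    (hc : LoopInvariant H P n c) (h : VacuumStep prot H P c c') : LoopInvariant H P n c' := by
  have hj := (hH.view_interval P).1
  rw [hn] at hj
  have hj' : H.joinView P < n := by exact_mod_cast hj
  obtain ⟨hreq, hin, hjv, hini, huni, hlt, hundo⟩ := hc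
  have hview : ∀ v : ℕ, H.removalView P ≠ ((v + 1 : ℕ) : ℕ∞) → v + 1 ≠ n := by
    rintro v h rfl
    exact h hn
  cases h with
  | undoHalt i tr hs hi ht =>
    obtain rfl : n = i := by
      rw [hn] at hi
      exact_mod_cast hi
    refine ⟨hreq, hin, ?_, fun _ h => ?_, fun h => ⟨(huni h).1, (huni h).2.1, by simp⟩, ?_, by simp⟩
    · change H.joinView P ≤ n - 1 + 1
      omega
    · simpa [ht] using (huni h).2.2 hs
    · intro _ _
      change n - 1 < n
      omega
  | noHalt hs ht =>
    refine ⟨hreq, hin, hjv, hini, fun h => ⟨(huni h).1, (huni h).2.1, by simp⟩, ?_, by simp⟩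
    intro _ _
    refine (hundo hs).resolve_right ?_
    rintro ⟨tr, h⟩
    exact ht n hn (by simp [h])
  | emit m out hs hp =>
    refine ⟨hreq, hin, hjv, hini, fun h => ?_, hlt, fun h => absurd h hs⟩
    simpa [hp] using (huni h).1
  | finished hs hp =>
    exact ⟨hreq, hin, hjv, hini, fun h => ⟨(huni h).1, (huni h).2.1, by simp⟩,
      fun _ _ => hlt (by simp [hs]) (by simp [hs]), by simp⟩
  | request s r hs hp hst hv hr =>
    exact ⟨hreq.subset Set.sdiff_subset, hin, hjv, by simp [LoopState.process],
      by simp [LoopState.process], hlt, fun h => absurd (hs.symm.trans h) (by simp)⟩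
  | noRequest hs hp _ =>
    exact ⟨hreq, hin, hjv, hini, fun h => ⟨(huni h).1, (huni h).2.1, by simp⟩,
      fun _ _ => hlt (by simp [hs]) (by simp [hs]), by simp⟩
  | packet s k hs hp hst hv hk _ =>
    exact ⟨hreq, hin.subset Set.sdiff_subset, hjv, by simp [LoopState.process],
      by simp [LoopState.process], hlt, fun h => absurd (hs.symm.trans h) (by simp)⟩
  | noPacket hs hp _ =>
    exact ⟨hreq, hin, hjv, hini, fun h => ⟨(huni h).1, (huni h).2.1, by simp⟩,
      fun _ _ => hlt (by simp [hs]) (by simp [hs]), by simp⟩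
  | selfPacket s k ks hs hp hst hk =>
    exact ⟨hreq, hin, hjv, by simp [LoopState.process],
      by simp [LoopState.process], hlt, fun h => absurd (hs.symm.trans h) (by simp)⟩
  | noSelfPacket hs hp _ =>
    exact ⟨hreq, hin, hjv, hini, fun h => ⟨(huni h).1, (huni h).2.1, by simp⟩,
      fun _ _ => hlt (by simp [hs]) (by simp [hs]), by simp⟩
  | halt hs hp hv =>
    have hv' : n = c.v + 1 := by
      rw [hn] at hv
      exact_mod_cast hv
    refine ⟨hreq, hin, ?_, fun _ => hini (by omega), fun h => ⟨(huni h).1, (huni h).2.1, by simp⟩,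
      by simp, by simp⟩
    change H.joinView P ≤ c.v + 1 + 1
    omega
  | fork l s hs hp hv _ _ =>
    refine ⟨hreq, hin, ?_, by simp [LoopState.process], by simp [LoopState.process],
      fun _ _ => ?_, by simp⟩
    · change H.joinView P ≤ c.v + 1 + 1
      omega
    · change c.v + 1 < n
      omega
  | notify s t hs hp hst hv ht =>
    have := hlt (by simp [hs]) (by simp [hs])
    have := hview _ hv
    refine ⟨hreq, hin, ?_, by simp [LoopState.process], by simp [LoopState.process],
      fun _ _ => ?_, by simp⟩
    · change H.joinView P ≤ c.v + 1 + 1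
      omega
    · change c.v + 1 < n
      omega

/-- The vacuum loop can always be continued until it exits. -/
theorem LoopInvariant.exists_step (hH : H.IsHistory) (hE : Executes prot H)
    (hP : 0 < H.joinView P → .notify (H.joinView P) (H.parent P) ∈ H.events) {n : ℕ}
    (hn : H.removalView P = n) {c : Loop} (hc : LoopInvariant H P n c) (hs : c.step ≠ .exited) :
    ∃ c', VacuumStep prot H P c c' := by
  by_cases h0 : c.step = .undoHalt
  · by_cases ht : ∀ i : ℕ, H.removalView P = i → c.trace.head? ≠ some (.old (.notify i P))
    · exact ⟨_, .noHalt c h0 ht⟩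
    · push Not at ht
      obtain ⟨i, hi, ht⟩ := ht
      obtain ⟨tr, ht⟩ := List.head?_eq_some_iff.1 ht
      exact ⟨_, .undoHalt c i tr h0 hi ht⟩
  rcases hp : c.pending with _ | ⟨m, out⟩
  swap
  · exact ⟨_, .emit c m out h0 hp⟩
  have hlt := hc.view_lt h0 hs
  cases hstep : c.step with
  | undoHalt => exact absurd hstep h0
  | finish => exact ⟨_, .finished c hstep hp⟩
  | requests =>
    by_cases h : c.v < H.joinView P ∨ c.requests = ∅
    · exact ⟨_, .noRequest c hstep hp h⟩
    · rw [not_or, not_lt, ← ne_eq, ← Set.nonempty_iff_ne_empty] at h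
      obtain ⟨hv, r, hr⟩ := h
      obtain ⟨s, hst⟩ := Option.ne_none_iff_exists'.1 (hc.initialized hv)
      exact ⟨_, .request c s r hstep hp hst hv hr⟩
  | packets =>
    by_cases h : H.removalView P ≠ ((c.v + 1 : ℕ) : ℕ∞) ∨ c.inbox = ∅
    · exact ⟨_, .noPacket c hstep hp h⟩
    · rw [not_or, not_not, ← ne_eq, ← Set.nonempty_iff_ne_empty] at h
      obtain ⟨hv, hne⟩ := h
      have hj := (hH.view_interval P).1
      rw [hv] at hj
      have hj' : H.joinView P < c.v + 1 := by exact_mod_cast hj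
      obtain ⟨s, hst⟩ := Option.ne_none_iff_exists'.1 (hc.initialized (by omega))
      have : IsStrictOrder Pkt fun k k' => H.lt (H.queueEvent k) (H.queueEvent k') :=
        { irrefl := fun k => HistoryData.lt_irrefl _
          trans := fun _ _ _ h h' => hH.lt_trans h h' }
      obtain ⟨k, hk, hmin⟩ := (hc.inbox.wellFoundedOn
        (r := fun k k' => H.lt (H.queueEvent k) (H.queueEvent k'))).has_min
        Set.univ ⟨⟨_, hne.some_mem⟩, trivial⟩
      exact ⟨_, .packet c s k hstep hp hst hv k.2 fun k' hk' _ => hmin ⟨k', hk'⟩ trivial⟩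
  | selfPackets =>
    rcases hq : c.recvQueue P with _ | ⟨k, ks⟩
    · exact ⟨_, .noSelfPacket c hstep hp hq⟩
    · have hne : c.state ≠ none := fun h => by simpa [hq] using (hc.uninitialized h).2.1
      obtain ⟨s, hst⟩ := Option.ne_none_iff_exists'.1 hne
      exact ⟨_, .selfPacket c s k ks hstep hp hst hq⟩
  | nextView =>
    by_cases hr : H.removalView P = ((c.v + 1 : ℕ) : ℕ∞)
    · exact ⟨_, .halt c hstep hp hr⟩
    rcases hc.joinView_le.eq_or_lt with hv | hv
    · obtain ⟨l, s, hl, hseg⟩ := hE.exists_parent_run hH (by omega) (hP (by omega))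
      exact ⟨_, .fork c l s hstep hp hv.symm hl hseg⟩
    · obtain ⟨s, hst⟩ := Option.ne_none_iff_exists'.1 (hc.initialized (by omega))
      have hlt' : ((c.v + 1 : ℕ) : ℕ∞) < H.removalView P := by
        refine lt_of_le_of_ne ?_ (Ne.symm hr)
        rw [hn]
        exact_mod_cast hlt
      rcases hH.exists_change (by omega) hlt' with ⟨J, h⟩ | ⟨R, h⟩
      · exact ⟨_, .notify c s _ hstep hp hst hr (.joined _ _ _ h)⟩
      · exact ⟨_, .notify c s _ hstep hp hst hr (.removed _ _ h)⟩
  | exited => exact absurd hstep hs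

/-- The remaining steps of the loop control: the views up to `n`, and the steps in the present
view. -/
def LoopState.phase (n : ℕ) (c : Loop) : ℕ :=
  match c.step with
  | .undoHalt => 7 * n + 7
  | .finish => 7 * (n - c.v) + 6
  | .requests => 7 * (n - c.v) + 5
  | .packets => 7 * (n - c.v) + 4
  | .selfPackets => 7 * (n - c.v) + 3
  | .nextView => 7 * (n - c.v) + 2
  | .exited => 0

variable (H P) in
/-- The termination measure of the vacuum loop.  Its components count the loop control, the items
that come from outside, the rank and the weight of the packets that the process sends to itself.
Side effects that are not yet carried out count as if all of them were such packets, and weigh one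
more. -/
def LoopState.progress (rank weight : prot.Content → ℕ) (credit : prot.State → ℕ) (n : ℕ)
    (c : Loop) : ℕ ×ₗ ℕ ×ₗ ℕ ×ₗ ℕ :=
  toLex (c.phase n, toLex (c.requests.ncard + c.inbox.ncard,
    toLex (((c.recvQueue P).map fun k => rank (k.content prot H)).sum + effectWeight rank c.pending,
      ((c.recvQueue P).map fun k => weight (k.content prot H)).sum +
        effectWeight (fun x => weight x + 1) c.pending + c.state.elim 0 credit)))

/-- The protocol calls for packets must decrease rank or weight; the other calls are unrestricted,
since each of them uses up a request, a packet from another process or a view. -/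
theorem LoopInvariant.progress_lt {rank weight : prot.Content → ℕ}
    {credit : prot.State → ℕ}
    (hpot : ∀ c Q s, effectWeight rank (prot.packet c Q s).2 < rank c ∨
      effectWeight rank (prot.packet c Q s).2 ≤ rank c ∧
      credit (prot.packet c Q s).1 + effectWeight (fun x => weight x + 1) (prot.packet c Q s).2 <
        credit s + weight c)
    {n : ℕ} {c c' : Loop} (hc : LoopInvariant H P n c)
    (h : VacuumStep prot H P c c') :
    c'.progress H P rank weight credit n < c.progress H P rank weight credit n := by
  have hlex : ∀ {a₁ a₂ a₃ a₄ b₁ b₂ b₃ b₄ : ℕ},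
      (a₁ < b₁ ∨ a₁ = b₁ ∧ (a₂ < b₂ ∨ a₂ = b₂ ∧ (a₃ < b₃ ∨ a₃ ≤ b₃ ∧ a₄ < b₄))) →
      toLex (a₁, toLex (a₂, toLex (a₃, a₄))) < toLex (b₁, toLex (b₂, toLex (b₃, b₄))) := by
    intro a₁ a₂ a₃ a₄ b₁ b₂ b₃ b₄ h
    simp only [Prod.Lex.toLex_lt_toLex]
    omega
  apply hlex
  have hlt := hc.view_lt
  cases h with
  | undoHalt i tr hs hi ht =>
    left
    simp only [LoopState.phase, hs]
    omega
  | noHalt hs ht =>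
    left
    simp only [LoopState.phase, hs]
    omega
  | emit m out hs hp =>
    refine .inr ⟨rfl, .inr ⟨rfl, .inr ?_⟩⟩
    simp only [LoopState.emit, hp, effectWeight_cons]
    split_ifs <;> simp [LoopPacket.content]
    omega
  | finished hs hp =>
    left
    simp only [LoopState.phase, hs]
    omega
  | request s r hs hp hst hv hr =>
    refine .inr ⟨rfl, .inl ?_⟩
    exact Nat.add_lt_add_right (Set.ncard_sdiff_singleton_lt_of_mem hr hc.requests) _
  | noRequest hs hp _ =>
    left
    simp only [LoopState.phase, hs]
    omega
  | packet s k hs hp hst hv hk _ =>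
    refine .inr ⟨rfl, .inl ?_⟩
    exact Nat.add_lt_add_left (Set.ncard_sdiff_singleton_lt_of_mem hk hc.inbox) _
  | noPacket hs hp _ =>
    left
    simp only [LoopState.phase, hs]
    omega
  | selfPacket s k ks hs hp hst hk =>
    refine .inr ⟨rfl, .inr ⟨rfl, ?_⟩⟩
    have := hpot (k.content prot H) P s
    simp only [LoopState.process, hst, hk, hp, Function.update_self, List.map_cons, List.sum_cons,
      effectWeight_nil, Option.elim_some]
    omega
  | noSelfPacket hs hp _ =>
    left
    simp only [LoopState.phase, hs]
    omega
  | halt hs hp hv =>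
    left
    simp only [LoopState.phase, hs]
    omega
  | fork l s hs hp hv _ _ =>
    left
    have := hlt (by simp [hs]) (by simp [hs])
    simp only [LoopState.phase, hs]
    omega
  | notify s t hs hp hst hv ht =>
    left
    have := hlt (by simp [hs]) (by simp [hs])
    simp only [LoopState.phase, hs]
    omega

end VacuumLoop

/-- A protocol is vacuum convergent if each packet loses rank or, without a gain of rank, weight
when it is replaced by the side effects of its processing. -/
theorem vacuumConvergent_of_potential {Proc M : Type u} {prot : Protocol Proc M}
    (rank weight : prot.Content → ℕ) (credit : prot.State → ℕ)
    (hpot : ∀ c Q s, effectWeight rank (prot.packet c Q s).2 < rank c ∨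
      effectWeight rank (prot.packet c Q s).2 ≤ rank c ∧
      credit (prot.packet c Q s).1 + effectWeight (fun x => weight x + 1) (prot.packet c Q s).2 <
        credit s + weight c) :
    VacuumConvergent prot := by
  intro Pkt Mc Req H hH hC hL hE P hP hpar
  obtain ⟨n, hn⟩ := ENat.ne_top_iff_exists.1 (hC.membership P hP)
  refine ⟨exists_isHaltingState hH hE hP hn.symm, fun c hc => ⟨?_, fun c' hcc' hstuck => ?_⟩⟩
  · rintro ⟨run, h0, hrun⟩
    have hinv : ∀ i, LoopInvariant H P n (run i) := by
      intro i
      induction i with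
      | zero => exact h0 ▸ hc.invariant hH hL hP hn.symm
      | succ i ih => exact ih.step hH hn.symm (hrun i)
    exact not_strictAnti_of_wellFoundedLT
      (fun i => (run i).progress H P rank weight credit n)
      (strictAnti_nat_of_succ_lt fun i => (hinv i).progress_lt hpot (hrun i))
  · have hinv : LoopInvariant H P n c' := by
      clear hstuck
      induction hcc' with
      | refl => exact hc.invariant hH hL hP hn.symm
      | tail _ h ih => exact ih.step hH hn.symm h
    by_contra hs
    obtain ⟨c'', h⟩ := hinv.exists_step hH hE hpar hn.symm hs
    exact hstuck c'' h

/-! ### The potential of CBCAST -/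

namespace CBCAST

variable {Proc M D : Type u}

/-- The number of generations of donation packets that a packet can cause when it is dequeued: a
donation is answered by a co-donation, and nothing else makes either of them. -/
def Content.rank : Content Proc M → ℕ
  | .donation _ => 2
  | .coDonation _ => 1
  | _ => 0

/-- The weight of a packet in a receive queue.  In a list of side effects it counts one more, which
pays for the queuing; thus a message, which is answered by an acknowledgement, has weight three. -/
def Content.weight : Content Proc M → ℕ
  | .message _ => 3
  | _ => 1

/-- What a state can still contribute to the side effects of packets: the messages of the launch
queue, and a ghost and a flush packet for the present height. -/
def State.credit (s : State Proc M D) : ℕ :=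
  2 * min 1 (s.height - s.ghostHeight) + 2 * min 1 (s.height - s.flushHeight) +
    5 * s.launchQueue.length

/-- The credit of a state together with the weight of the side effects collected so far. -/
def State.potential (s : State Proc M D) : ℕ :=
  s.credit + effectWeight (fun c => c.weight + 1) s.out

/-- From `s` to `t` the potential grows by at most `n`, and no donation or co-donation is made. -/
def Spends (n : ℕ) (s t : State Proc M D) : Prop :=
  t.potential ≤ s.potential + n ∧ effectWeight Content.rank t.out = effectWeight Content.rank s.out

theorem Spends.trans {m n : ℕ} {s t r : State Proc M D} (h : Spends m s t) (h' : Spends n t r) :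
    Spends (m + n) s r :=
  ⟨by have := h.1; have := h'.1; omega, h'.2.trans h.2⟩

theorem Spends.mono {m n : ℕ} {s t : State Proc M D} (h : Spends m s t) (hmn : m ≤ n) :
    Spends n s t :=
  ⟨h.1.trans (by omega), h.2⟩

/-- The potential depends on these components only. -/
theorem Spends.of_eq {s t : State Proc M D} (h₁ : t.out = s.out)
    (h₂ : t.launchQueue = s.launchQueue) (h₃ : t.ghostHeight = s.ghostHeight)
    (h₄ : t.flushHeight = s.flushHeight) (h₅ : t.height = s.height) : Spends 0 s t := by
  simp [Spends, State.potential, State.credit, h₁, h₂, h₃, h₄, h₅]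

theorem Spends.refl (s : State Proc M D) : Spends 0 s s := .of_eq rfl rfl rfl rfl rfl

theorem Spends.foldl {α : Type*} {n : ℕ} {f : State Proc M D → α → State Proc M D}
    (h : ∀ s a, Spends n s (f s a)) (l : List α) (s : State Proc M D) :
    Spends (n * l.length) s (l.foldl f s) := by
  induction l generalizing s with
  | nil => exact .refl s
  | cons a l ih =>
    refine ((h s a).trans (ih (f s a))).mono ?_
    simp only [List.length_cons]
    ring_nf
    exact le_rfl

theorem spends_queue (s : State Proc M D) (c : Content Proc M) (T : Finset Proc)
    (hc : c.rank = 0) : Spends (c.weight + 1) s (s.queue c T) := by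
  simp [Spends, State.potential, State.credit, State.queue, State.height, hc]
  omega

theorem spends_checkFlush (s : State Proc M D) : Spends 0 s (checkFlush s) := by
  have h₁ : Spends 0 s (if s.ghostHeight < s.height then
      ({ s with ghostHeight := s.height } : State Proc M D).queue (.ghost s.height) s.contactSet
      else s) := by
    split_ifs
    · simp [Spends, State.potential, State.credit, State.queue, State.height, Content.rank,
        Content.weight] at *
      omega
    · exact .refl s
  have h₂ : ∀ s₁ : State Proc M D, Spends 0 s₁ (if s₁.flushHeight < s₁.height then
      ({ s₁ with flushHeight := s₁.height } : State Proc M D).queue (.flush s₁.height)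
        s₁.contactSet else s₁) := by
    intro s₁
    split_ifs
    · simp [Spends, State.potential, State.credit, State.queue, State.height, Content.rank,
        Content.weight] at *
      omega
    · exact .refl s₁
  have h₃ : ∀ s₁ : State Proc M D, Spends 0 s s₁ → Spends 0 s (if s₁.bcastWaitSet ≠ ∅ then s₁ else
      if s₁.flushHeight < s₁.height then
        ({ s₁ with flushHeight := s₁.height } : State Proc M D).queue (.flush s₁.height)
          s₁.contactSet else s₁) := by
    intro s₁ h
    by_cases hb : s₁.bcastWaitSet ≠ ∅
    · rwa [if_pos hb]
    · rw [if_neg hb]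
      exact h.trans (h₂ s₁)
  unfold checkFlush
  by_cases hF : s.fwdWaitSet ≠ ∅
  · rw [if_pos hF]
    exact .refl s
  · rw [if_neg hF]
    exact h₃ _ h₁

theorem spends_protBroadcast (m : M) (s : State Proc M D) : Spends 5 s (protBroadcast m s) := by
  unfold protBroadcast
  split_ifs
  · simp [Spends, State.potential, State.credit, State.height]
    omega
  · simp [Spends, State.potential, State.credit, State.height, State.queue, Content.rank,
      Content.weight]
    omega

/-- `t` agrees with `s` in all components that bear on views, heights and side effects. -/
def SameFrame (s t : State Proc M D) : Prop :=
  t.out = s.out ∧ t.launchQueue = s.launchQueue ∧ t.ghostHeight = s.ghostHeight ∧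
    t.flushHeight = s.flushHeight ∧ t.curView = s.curView ∧ t.vGap = s.vGap

theorem SameFrame.refl (s : State Proc M D) : SameFrame s s := ⟨rfl, rfl, rfl, rfl, rfl, rfl⟩

theorem SameFrame.trans {s t r : State Proc M D} (h : SameFrame s t) (h' : SameFrame t r) :
    SameFrame s r :=
  ⟨h'.1.trans h.1, h'.2.1.trans h.2.1, h'.2.2.1.trans h.2.2.1, h'.2.2.2.1.trans h.2.2.2.1,
    h'.2.2.2.2.1.trans h.2.2.2.2.1, h'.2.2.2.2.2.trans h.2.2.2.2.2⟩

theorem SameFrame.spends {s t : State Proc M D} (h : SameFrame s t) : Spends 0 s t :=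
  .of_eq h.1 h.2.1 h.2.2.1 h.2.2.2.1 (by simp [State.height, h.2.2.2.2.1, h.2.2.2.2.2])

variable (env : Env Proc M D)

theorem sameFrame_scanPass (s : State Proc M D) : SameFrame s (scanPass env s) := by
  unfold scanPass
  generalize env.enumMsg s.receiveSet = l
  induction l generalizing s with
  | nil => exact .refl s
  | cons m l ih =>
    refine SameFrame.trans ?_ (ih (scanOne env s m))
    unfold scanOne
    split_ifs
    · exact ⟨rfl, rfl, rfl, rfl, rfl, rfl⟩
    · exact .refl s

theorem sameFrame_scan (s : State Proc M D) : SameFrame s (scan env s) := by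
  unfold scan
  generalize s.receiveSet.card = n
  induction n generalizing s with
  | zero => exact .refl s
  | succ n ih => exact (sameFrame_scanPass env s).trans (ih _)

/-- The installation of views does not change the overall height, as long as there is a gap. -/
theorem spends_iterate_installNext (n : ℕ) (s : State Proc M D) (hn : n ≤ s.vGap) :
    Spends 0 s ((installNext env)^[n] s) := by
  induction n generalizing s with
  | zero => exact .refl s
  | succ n ih =>
    obtain ⟨h₁, h₂, h₃, h₄, h₅, h₆⟩ : (installNext env s).out = s.out ∧
        (installNext env s).launchQueue = s.launchQueue ∧
        (installNext env s).ghostHeight = s.ghostHeight ∧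
        (installNext env s).flushHeight = s.flushHeight ∧
        (installNext env s).curView = s.curView + 1 ∧ (installNext env s).vGap = s.vGap - 1 := by
      unfold installNext
      rcases s.pendViewQueue with _ | ⟨_ | _, _⟩ <;> exact sameFrame_scan env _
    refine Spends.trans (m := 0) (n := 0) (.of_eq h₁ h₂ h₃ h₄ ?_) (ih _ (by omega))
    simp only [State.height]
    omega

theorem spends_tryToInstall (s : State Proc M D) : Spends 0 s (tryToInstall env s) := by
  unfold tryToInstall
  split_ifs
  · exact .refl s
  · have h := spends_iterate_installNext env s.vGap s le_rfl
    set s₁ := (installNext env)^[s.vGap] s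
    have h' := Spends.foldl (fun s m => spends_protBroadcast (D := D) m s) s₁.launchQueue
      { s₁ with launchQueue := [] }
    refine ⟨?_, h'.2.trans h.2⟩
    -- the credit of the emptied launch queue pays for the broadcasts
    have h₁ : ({ s₁ with launchQueue := [] } : State Proc M D).potential +
        5 * s₁.launchQueue.length = s₁.potential := by
      simp [State.potential, State.credit, State.height]
      omega
    exact h'.1.trans (h₁.le.trans h.1)

theorem spends_receiveMessage (m : Msg Proc M) (S : Proc) (s : State Proc M D) :
    Spends 2 s (receiveMessage env m S s) := by
  have h := spends_queue s (.ack m) {S} rfl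
  unfold receiveMessage
  dsimp only
  split_ifs <;> first
    | exact h.trans (n := 0) (.of_eq rfl rfl rfl rfl rfl)
    | refine Spends.trans (m := 2) (n := 0) ?_ (sameFrame_scan env _).spends
      exact h.trans (n := 0) (.of_eq rfl rfl rfl rfl rfl)

theorem spends_receiveAck (m : Msg Proc M) (S : Proc) (s : State Proc M D) :
    Spends 0 s (receiveAck m S s) := by
  unfold receiveAck
  dsimp only
  split_ifs
  · exact Spends.trans (m := 0) (.of_eq rfl rfl rfl rfl rfl) (spends_checkFlush _)
  · exact .of_eq rfl rfl rfl rfl rfl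

theorem spends_receiveUnt (d : Donation Proc M) (S : Proc) (s : State Proc M D)
    (x : Unt Proc M) : Spends 2 s (receiveUnt env d S s x) := by
  rcases x with w | w <;> unfold receiveUnt <;> dsimp only <;> split_ifs
  · exact (spends_receiveAck _ _ _).mono (by omega)
  · exact (Spends.refl s).mono (by omega)
  · exact spends_receiveMessage env _ _ _
  · exact (Spends.refl s).mono (by omega)

theorem exists_spends_receiveUnts (d : Donation Proc M) (S : Proc) (s : State Proc M D) :
    ∃ n, Spends n s (receiveUnts env d S s) :=
  ⟨_, (Spends.foldl (spends_receiveUnt env d S) _ s).trans (n := 0) (.of_eq rfl rfl rfl rfl rfl)⟩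

/-- A packet loses either rank or, without a gain of rank, weight when it is replaced by the side
effects of its processing. -/
theorem protPacket_decreases (c : Content Proc M) (S : Proc) (s : State Proc M D) :
    effectWeight Content.rank (call (protPacket env c S) s).2 < c.rank ∨
      effectWeight Content.rank (call (protPacket env c S) s).2 ≤ c.rank ∧
      (call (protPacket env c S) s).1.credit +
        effectWeight (fun c => c.weight + 1) (call (protPacket env c S) s).2 <
          s.credit + c.weight := by
  have key : ∀ n, n < c.weight →
      Spends n { s with out := [] } (protPacket env c S { s with out := [] }) →
      effectWeight Content.rank (call (protPacket env c S) s).2 ≤ c.rank ∧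
      (call (protPacket env c S) s).1.credit +
        effectWeight (fun c => c.weight + 1) (call (protPacket env c S) s).2 <
          s.credit + c.weight := by
    intro n hn h
    refine ⟨h.2.trans_le (Nat.zero_le _), ?_⟩
    exact h.1.trans_lt (Nat.add_lt_add_left hn s.credit)
  cases c with
  | message m => exact .inr (key 2 (by simp [Content.weight]) (spends_receiveMessage env m S _))
  | ack m => exact .inr (key 0 (by simp [Content.weight]) (spends_receiveAck m S _))
  | ghost v => exact .inr (key 0 (by simp [Content.weight]) (.of_eq rfl rfl rfl rfl rfl))
  | flush v =>
    refine .inr (key 0 (by simp [Content.weight]) ?_)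
    exact Spends.trans (m := 0) (.of_eq rfl rfl rfl rfl rfl) (spends_tryToInstall env _)
  | donation d =>
    left
    obtain ⟨n, h⟩ := exists_spends_receiveUnts env d S
      (({ s with out := [], contactSet := insert S s.contactSet } : State Proc M D).queue
        (.coDonation ({ s with out := [], contactSet := insert S s.contactSet } :
          State Proc M D).donation) {S})
    refine h.2.trans_lt ?_
    simp [State.queue, Content.rank]
  | coDonation d =>
    left
    obtain ⟨n, h⟩ := exists_spends_receiveUnts env d S { s with out := [] }
    exact (h.trans (spends_tryToInstall env _)).2.trans_lt (by simp [Content.rank])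

end CBCAST

end

/-- The CBCAST protocol is vacuum convergent. -/
theorem mainTheorem7 {Proc M D : Type u} (env : CBCAST.Env Proc M D) :
    VacuumConvergent (CBCAST.protocol env) := by
  exact vacuumConvergent_of_potential CBCAST.Content.rank CBCAST.Content.weight CBCAST.State.credit
    (CBCAST.protPacket_decreases env)
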